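/- Let $\mathcal M^*$ be the set of positive Borel measures $\mu$ on $\mathbb R$ with infinite support and $\int |x|^n\,d\mu(x)<\infty$ for all $n\ge 0$. A measure $\mu\in\mathcal M^*$ is called determinate if it is the only measure in $\mathcal M^*$ with the moments $s_n=\int x^n\,d\mu(x)$, $n\ge0$, and indeterminate otherwise; $\mathcal M_d^*$ and $\mathcal M_i^*$ are the sets of determinate and of indeterminate measures in $\mathcal M^*$. For $\mu\in\mathcal M_i^*$ let $p_n$ ($n\ge 0$) be the orthonormal polynomials of $\mu$ ($\deg p_n=n$, positive leading coefficient, $\int p_np_m\,d\mu=\delta_{n,m}$), let $q_n(z)=\int\frac{p_n(z)-p_n(x)}{z-x}\,d\mu(x)$ be the polynomials of the second kind, and let $$A(z)=z\sum_{n=0}^\infty q_n(0)q_n(z),\quad B(z)=-1+z\sum_{n=0}^\infty q_n(0)p_n(z),$$ $$C(z)=1+z\sum_{n=0}^\infty p_n(0)q_n(z),\quad D(z)=z\sum_{n=0}^\infty p_n(0)p_n(z)$$ be the entire functions of the Nevanlinna parametrization. The measure $\mu\in\mathcal M_i^*$ is called N-extremal if, for some $t\in\mathbb R\cup\{\infty\}$,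 $$\int\frac{d\mu(x)}{x-z}=-\frac{A(z)+tC(z)}{B(z)+tD(z)}\quad\text{for all } z\in\mathbb C\setminus\mathbb R,$$ where the right-hand side is $-C(z)/D(z)$ if $t=\infty$. Let $\mathcal M_{i,0}^*$ be the set of N-extremal measures in $\mathcal M_i^*$. For $0\le\alpha\le 1$ put $$A(\alpha)=\{\mu\in\mathcal M_i^* : (1+x^2)^{-\alpha}d\mu(x)\in\mathcal M_i^*\},\quad B(\alpha)=\{\mu\in\mathcal M_i^* : (1+x^2)^{-\alpha}d\mu(x)\in\mathcal M_d^*\}.$$ Theorem. For every $0<\alpha<1$, $$A(\alpha)\cap\mathcal M_{i,0}^*\ne\emptyset\quad\text{and}\quad\emptyset\ne B(\alpha)\subseteq\mathcal M_{i,0}^*.$$ -/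

import Mathlib

open MeasureTheory

namespace HamburgerMoment

/-- `𝓜*`: the positive Borel measures on `ℝ` with infinite support and moments of every order
(the moment of order `0` makes them finite). -/
def MStar : Set (Measure ℝ) :=
  {μ | μ.support.Infinite ∧ ∀ n : ℕ, Integrable (fun x : ℝ => x ^ n) μ}

/-- The `n`-th moment `s_n = ∫ xⁿ dμ(x)`. -/
noncomputable def moment (μ : Measure ℝ) (n : ℕ) : ℝ := ∫ x, x ^ n ∂μ

/-- `V`: the measures in `𝓜*` that have the same moment sequence as `μ`. -/
def solutions (μ : Measure ℝ) : Set (Measure ℝ) :=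
  {ν | ν ∈ MStar ∧ ∀ n : ℕ, moment ν n = moment μ n}

/-- `𝓜*_d`: the determinate measures. -/
def MDet : Set (Measure ℝ) :=
  {μ | μ ∈ MStar ∧ ∀ ν ∈ solutions μ, ν = μ}

/-- `𝓜*_i`: the indeterminate measures. -/
def MIndet : Set (Measure ℝ) :=
  {μ | μ ∈ MStar ∧ ∃ ν ∈ solutions μ, ν ≠ μ}

/-- `p` is the sequence of orthonormal polynomials of `μ`: `p n` has degree `n` and positive
leading coefficient, and `∫ p_n p_m dμ = δ_{n,m}`. For `μ ∈ 𝓜*` there is exactly one such `p`. -/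
def IsOrthonormalPolynomials (μ : Measure ℝ) (p : ℕ → Polynomial ℝ) : Prop :=
  (∀ n, (p n).natDegree = n ∧ 0 < (p n).leadingCoeff) ∧
  ∀ n m, ∫ x, (p n).eval x * (p m).eval x ∂μ = if n = m then 1 else 0

/-- The value `p_n(z)` at a complex point. -/
noncomputable def evalP (p : ℕ → Polynomial ℝ) (n : ℕ) (z : ℂ) : ℂ :=
  Polynomial.aeval z (p n)

/-- The polynomials of the second kind, `q_n(z) = ∫ (p_n(z) - p_n(x)) / (z - x) dμ(x)`.
The integrand is a polynomial in `x` and `z`; `dslope` is the difference quotient, with the value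
`p_n'(z)` at `x = z`. -/
noncomputable def evalQ (μ : Measure ℝ) (p : ℕ → Polynomial ℝ) (n : ℕ) (z : ℂ) : ℂ :=
  ∫ x : ℝ, dslope (evalP p n) (x : ℂ) z ∂μ

/-- `A(z) = z ∑ q_n(0) q_n(z)`. -/
noncomputable def nevA (μ : Measure ℝ) (p : ℕ → Polynomial ℝ) (z : ℂ) : ℂ :=
  z * ∑' n, evalQ μ p n 0 * evalQ μ p n z

/-- `B(z) = -1 + z ∑ q_n(0) p_n(z)`. -/
noncomputable def nevB (μ : Measure ℝ) (p : ℕ → Polynomial ℝ) (z : ℂ) : ℂ :=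
  -1 + z * ∑' n, evalQ μ p n 0 * evalP p n z

/-- `C(z) = 1 + z ∑ p_n(0) q_n(z)`. -/
noncomputable def nevC (μ : Measure ℝ) (p : ℕ → Polynomial ℝ) (z : ℂ) : ℂ :=
  1 + z * ∑' n, evalP p n 0 * evalQ μ p n z

/-- `D(z) = z ∑ p_n(0) p_n(z)`. -/
noncomputable def nevD (p : ℕ → Polynomial ℝ) (z : ℂ) : ℂ :=
  z * ∑' n, evalP p n 0 * evalP p n z

/-- The Stieltjes transform `∫ dμ(x) / (x - z)`. -/
noncomputable def stieltjesTransform (μ : Measure ℝ) (z : ℂ) : ℂ :=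
  ∫ x : ℝ, 1 / ((x : ℂ) - z) ∂μ

/-- `μ` is the solution that corresponds, in the Nevanlinna parametrization
`∫ dμ_φ(x) / (x - z) = -(A(z) + φ(z) C(z)) / (B(z) + φ(z) D(z))`, `z ∈ ℂ ∖ ℝ`, of the solutions of
its moment problem, to a real constant `φ = t` or to `φ = ∞`. Used for indeterminate `μ` only:
there the four series converge for every `z`, and the denominators have no zero off `ℝ`. -/
def IsNExtremal (μ : Measure ℝ) : Prop :=
  ∃ p : ℕ → Polynomial ℝ, IsOrthonormalPolynomials μ p ∧
    ((∃ t : ℝ, ∀ z : ℂ, z.im ≠ 0 →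
        stieltjesTransform μ z =
          -((nevA μ p z + (t : ℂ) * nevC μ p z) / (nevB μ p z + (t : ℂ) * nevD p z))) ∨
      ∀ z : ℂ, z.im ≠ 0 → stieltjesTransform μ z = -(nevC μ p z / nevD p z))

/-- `𝓜*_{i,0}`: the indeterminate N-extremal measures. -/
def MIndetNExt : Set (Measure ℝ) := {μ | μ ∈ MIndet ∧ IsNExtremal μ}

/-- The measure `(1 + x²)^(-α) dμ(x)`. -/
noncomputable def damp (α : ℝ) (μ : Measure ℝ) : Measure ℝ :=
  μ.withDensity fun x => ENNReal.ofReal ((1 + x ^ 2) ^ (-α))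

/-- `A(α)`: the indeterminate `μ` for which `(1 + x²)^(-α) dμ(x)` is indeterminate. -/
def setA (α : ℝ) : Set (Measure ℝ) := {μ | μ ∈ MIndet ∧ damp α μ ∈ MIndet}

/-- `B(α)`: the indeterminate `μ` for which `(1 + x²)^(-α) dμ(x)` is determinate. -/
def setB (α : ℝ) : Set (Measure ℝ) := {μ | μ ∈ MIndet ∧ damp α μ ∈ MDet}

end HamburgerMoment

/-!
Everything is controlled by the evaluations `P ↦ P(z)` on the polynomials, with the norm of
`L²(μ)`; `EvalBounded μ z` says that such an evaluation is bounded.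

* If no evaluation at a point off `ℝ` is bounded, then each Cauchy kernel `1 / (x - z)` is a limit
  of polynomials in a norm that controls its integral against every solution of the moment problem.
  The Stieltjes transforms of all solutions agree and `μ` is determinate
  (`mem_MDet_of_not_evalBounded`).
* If the evaluation at `i` is bounded, the positive functional `R ↦ ∫ R / (1 + x²) dμ` on
  polynomials remains positive after the addition of a suitable multiple of `R(i)`. The M. Riesz
  extension theorem and the Riesz representation theorem turn it into a measure with the moments of
  `μ` and a different Stieltjes transform at `i`, so `μ` is indeterminate
  (`exists_ne_of_evalBounded`).
* If the evaluation at `i` is unbounded for `(1 + x²)⁻¹ dμ`, then the Cauchy kernel at `i` is a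
  limit of polynomials in `L²(μ)`, and Parseval's identity shows that the parameter of an
  indeterminate `μ` in the Nevanlinna parametrization is constant (`isNExtremal_of_evalBounded`).

Let `α ≤ 1`. If `(1 + x²)^(-α) dμ` is determinate, its evaluation at `i` is unbounded, and a
fortiori the one for `(1 + x²)⁻¹ dμ`. So `B(α)` consists of N-extremal measures.

Both nonemptiness claims follow from one measure `σ = ∑ aₙ² / (n + 1) · δ_{2ⁿ}`, where the numbers
`aₙ = (-1)ⁿ 2ⁿ / ∏_{j = 1}^n (2^j - 1)` satisfy `∑ aₙ P(2ⁿ) = 0` for all polynomials `P`. The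
polynomials `∏_{k < N} (x - 2^k)` show that no evaluation off `ℝ` is bounded for `(1 + x²)⁻¹ dσ`,
while the residue formula for `P(i)` and the convergence of `∑ (n + 1) 4^(-n (1 - β))` show that the
evaluation at `i` is bounded for `(1 + x²)^(-β) dσ` when `0 ≤ β < 1`. Hence `σ` is an N-extremal
measure in `A(α)`, and `(1 + x²)^(α - 1) dσ` is in `B(α)`.
-/

namespace HamburgerMoment

open Polynomial Filter Topology ComplexConjugate

/-! ### Polynomials as integrands -/

lemma isFiniteMeasure_of_mem_MStar {μ : Measure ℝ} (hμ : μ ∈ MStar) : IsFiniteMeasure μ := by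
  have h := hμ.2 0
  simp only [pow_zero] at h
  exact (integrable_const_iff_isFiniteMeasure one_ne_zero).1 h

lemma integrable_eval {μ : Measure ℝ} (hμ : μ ∈ MStar) (P : ℝ[X]) :
    Integrable (fun x : ℝ => P.eval x) μ := by
  induction P using Polynomial.induction_on' with
  | add p q hp hq => exact (hp.add hq).congr (ae_of_all _ fun x => by simp)
  | monomial n a => simpa using (hμ.2 n).const_mul a

lemma integrable_evalC {μ : Measure ℝ} (hμ : μ ∈ MStar) (P : ℂ[X]) :
    Integrable (fun x : ℝ => P.eval (x : ℂ)) μ := by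
  induction P using Polynomial.induction_on' with
  | add p q hp hq => exact (hp.add hq).congr (ae_of_all _ fun x => by simp)
  | monomial n a =>
    have h := ((hμ.2 n).ofReal (𝕜 := ℂ)).const_mul a
    simpa using h

lemma eval_map_conj (P : ℂ[X]) (z : ℂ) :
    (P.map (starRingEnd ℂ)).eval z = conj (P.eval (conj z)) := by
  induction P using Polynomial.induction_on' with
  | add p q hp hq => simp [hp, hq]
  | monomial n a => simp

lemma eval_mul_map_conj (P : ℂ[X]) (x : ℝ) :
    (P * P.map (starRingEnd ℂ)).eval (x : ℂ) = ((‖P.eval (x : ℂ)‖ ^ 2 : ℝ) : ℂ) := by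
  rw [eval_mul, eval_map_conj, Complex.conj_ofReal, Complex.mul_conj, Complex.normSq_eq_norm_sq]

lemma integrable_norm_sq {μ : Measure ℝ} (hμ : μ ∈ MStar) (P : ℂ[X]) :
    Integrable (fun x : ℝ => ‖P.eval (x : ℂ)‖ ^ 2) μ := by
  have h := (integrable_evalC hμ (P * P.map (starRingEnd ℂ))).re
  refine h.congr (ae_of_all _ fun x => ?_)
  simp only [eval_mul_map_conj]
  exact Complex.ofReal_re _

@[fun_prop]
lemma continuous_evalC (P : ℂ[X]) : Continuous fun x : ℝ => P.eval (x : ℂ) :=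
  P.continuous.comp Complex.continuous_ofReal

lemma memLp_evalC {μ : Measure ℝ} (hμ : μ ∈ MStar) (P : ℂ[X]) :
    MemLp (fun x : ℝ => P.eval (x : ℂ)) 2 μ :=
  (memLp_two_iff_integrable_sq_norm (continuous_evalC P).aestronglyMeasurable).2
    (integrable_norm_sq hμ P)

lemma integral_evalC_eq {μ τ : Measure ℝ} (hμ : μ ∈ MStar) (hτ : τ ∈ solutions μ) (P : ℂ[X]) :
    ∫ x : ℝ, P.eval (x : ℂ) ∂τ = ∫ x : ℝ, P.eval (x : ℂ) ∂μ := by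
  induction P using Polynomial.induction_on' with
  | add p q hp hq =>
    simp only [eval_add]
    rw [integral_add (integrable_evalC hτ.1 p) (integrable_evalC hτ.1 q),
      integral_add (integrable_evalC hμ p) (integrable_evalC hμ q), hp, hq]
  | monomial n a =>
    have h := hτ.2 n
    simp only [moment] at h
    simp only [eval_monomial, integral_const_mul, ← Complex.ofReal_pow, integral_complex_ofReal, h]

lemma integral_norm_sq_eq {μ τ : Measure ℝ} (hμ : μ ∈ MStar) (hτ : τ ∈ solutions μ) (P : ℂ[X]) :
    ∫ x : ℝ, ‖P.eval (x : ℂ)‖ ^ 2 ∂τ = ∫ x : ℝ, ‖P.eval (x : ℂ)‖ ^ 2 ∂μ := by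
  have h := integral_evalC_eq hμ hτ (P * P.map (starRingEnd ℂ))
  simp only [eval_mul_map_conj, integral_complex_ofReal] at h
  exact_mod_cast h

/-- A nonzero polynomial does not vanish almost everywhere for a measure of infinite support. -/
lemma integral_sq_pos {μ : Measure ℝ} (hμ : μ ∈ MStar) {P : ℝ[X]} (hP : P ≠ 0) :
    0 < ∫ x, P.eval x ^ 2 ∂μ := by
  have hint : Integrable (fun x => P.eval x ^ 2) μ := by
    exact (integrable_eval hμ (P ^ 2)).congr (ae_of_all _ fun x => by simp)
  have h0 : 0 ≤ ∫ x, P.eval x ^ 2 ∂μ := integral_nonneg fun x => sq_nonneg _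
  refine lt_of_le_of_ne h0 fun h => ?_
  rw [eq_comm, integral_eq_zero_iff_of_nonneg (fun x => sq_nonneg _) hint] at h
  have hsub : μ.support ⊆ {x | P.eval x = 0} := by
    apply Measure.support_subset_of_isClosed (isClosed_eq P.continuous continuous_const)
    filter_upwards [h] with x hx
    simpa using hx
  refine hμ.1 (Set.Finite.subset (P.roots.toFinset.finite_toSet) fun x hx => ?_)
  simpa [hP] using hsub hx

/-- The quotient `(P(x) - P(w)) / (x - w)`, as a polynomial in `x`. -/
noncomputable def divDiff (w : ℂ) (P : ℂ[X]) : ℂ[X] := P /ₘ (X - C w)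

lemma mul_divDiff (w : ℂ) (P : ℂ[X]) : (X - C w) * divDiff w P + C (P.eval w) = P := by
  have h := modByMonic_add_div P (X - C w)
  rw [modByMonic_X_sub_C_eq_C_eval] at h
  rw [divDiff, add_comm]; exact h

lemma eval_eq_divDiff (w x : ℂ) (P : ℂ[X]) :
    P.eval x = P.eval w + (x - w) * (divDiff w P).eval x := by
  conv_lhs => rw [← mul_divDiff w P]
  simp [add_comm]

/-! ### Boundedness of point evaluation -/

/-- Evaluation at `z` is bounded on the polynomials for the norm of `L²(μ)`. The best constant is
`1 / ρ(z)`, where `ρ(z)` is the minimum of `∫ |P|² dμ` over the polynomials with `P(z) = 1`. -/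
def EvalBounded (μ : Measure ℝ) (z : ℂ) : Prop :=
  ∃ K : ℝ, ∀ P : ℂ[X], ‖P.eval z‖ ^ 2 ≤ K * ∫ x : ℝ, ‖P.eval (x : ℂ)‖ ^ 2 ∂μ

lemma EvalBounded.exists_pos {μ : Measure ℝ} {z : ℂ} (h : EvalBounded μ z) :
    ∃ K : ℝ, 0 < K ∧ ∀ P : ℂ[X], ‖P.eval z‖ ^ 2 ≤ K * ∫ x : ℝ, ‖P.eval (x : ℂ)‖ ^ 2 ∂μ := by
  obtain ⟨K, hK⟩ := h
  refine ⟨max K 1, by positivity, fun P => (hK P).trans ?_⟩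
  exact mul_le_mul_of_nonneg_right (le_max_left _ _) (integral_nonneg fun x => sq_nonneg _)

lemma EvalBounded.mono {μ ν : Measure ℝ} {z : ℂ} (h : EvalBounded μ z) (hle : μ ≤ ν)
    (hν : ν ∈ MStar) : EvalBounded ν z := by
  obtain ⟨K, hK, h⟩ := h.exists_pos
  refine ⟨K, fun P => (h P).trans ?_⟩
  exact mul_le_mul_of_nonneg_left (integral_mono_measure hle
    (ae_of_all _ fun x => sq_nonneg _) (integrable_norm_sq hν P)) hK.le

/-- If evaluation at `z` is unbounded, the value `1` at `z` is attained with small norm. -/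
lemma exists_eval_one_of_not_evalBounded {μ : Measure ℝ} {z : ℂ} (h : ¬ EvalBounded μ z) {ε : ℝ}
    (hε : 0 < ε) : ∃ P : ℂ[X], P.eval z = 1 ∧ ∫ x : ℝ, ‖P.eval (x : ℂ)‖ ^ 2 ∂μ < ε := by
  simp only [EvalBounded, not_exists, not_forall, not_le] at h
  obtain ⟨P, hP⟩ := h ε⁻¹
  have hi : 0 ≤ ∫ x : ℝ, ‖P.eval (x : ℂ)‖ ^ 2 ∂μ := integral_nonneg fun x => sq_nonneg _
  have h0 : 0 < ‖P.eval z‖ ^ 2 := lt_of_le_of_lt (by positivity) hP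
  have hz : P.eval z ≠ 0 := by
    intro h; simp [h] at h0
  refine ⟨C (P.eval z)⁻¹ * P, by simp [hz], ?_⟩
  simp only [eval_mul, eval_C, norm_mul, mul_pow, integral_const_mul, norm_inv]
  rw [inv_pow, inv_mul_lt_iff₀ h0]
  rwa [inv_mul_lt_iff₀ hε, mul_comm] at hP

/-! ### The damped measures -/

lemma measurable_dampWeight (α : ℝ) : Measurable fun x : ℝ => (1 + x ^ 2) ^ (-α) := by
  fun_prop

lemma dampWeight_pos (α x : ℝ) : 0 < (1 + x ^ 2 : ℝ) ^ (-α) :=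
  Real.rpow_pos_of_pos (by positivity) _

lemma damp_damp (α β : ℝ) (μ : Measure ℝ) : damp α (damp β μ) = damp (α + β) μ := by
  rw [damp, damp, ← withDensity_mul _ (measurable_dampWeight β).ennreal_ofReal
    (measurable_dampWeight α).ennreal_ofReal, damp]
  congr 1
  funext x
  rw [Pi.mul_apply, ← ENNReal.ofReal_mul (dampWeight_pos β x).le,
    ← Real.rpow_add (by positivity)]
  congr 2; ring

lemma damp_zero (μ : Measure ℝ) : damp 0 μ = μ := by
  simp [damp]

lemma damp_anti {α β : ℝ} (h : α ≤ β) (μ : Measure ℝ) : damp β μ ≤ damp α μ := by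
  refine withDensity_mono (ae_of_all _ fun x => ENNReal.ofReal_le_ofReal ?_)
  exact Real.rpow_le_rpow_of_exponent_le (by nlinarith [sq_nonneg x]) (by linarith)

lemma damp_mem_MStar {α : ℝ} (hα : 0 ≤ α) {μ : Measure ℝ} (hμ : μ ∈ MStar) : damp α μ ∈ MStar := by
  refine ⟨hμ.1.mono (Measure.AbsolutelyContinuous.support_mono ?_), fun n => ?_⟩
  · refine withDensity_absolutelyContinuous'
      (measurable_dampWeight α).ennreal_ofReal.aemeasurable (ae_of_all _ fun x => ?_)
    simpa using dampWeight_pos α x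
  · exact (hμ.2 n).mono_measure (by simpa [damp_zero] using damp_anti hα μ)

lemma integral_damp (α : ℝ) (μ : Measure ℝ) (f : ℝ → ℝ) :
    ∫ x, f x ∂(damp α μ) = ∫ x, (1 + x ^ 2) ^ (-α) * f x ∂μ := by
  rw [damp, integral_withDensity_eq_integral_toReal_smul
    (measurable_dampWeight α).ennreal_ofReal (ae_of_all _ fun x => ENNReal.ofReal_lt_top)]
  refine integral_congr_ae (ae_of_all _ fun x => ?_)
  simp [ENNReal.toReal_ofReal (dampWeight_pos α x).le]

lemma integral_damp_one (μ : Measure ℝ) (f : ℝ → ℝ) :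
    ∫ x, f x ∂(damp 1 μ) = ∫ x, f x / (1 + x ^ 2) ∂μ := by
  rw [integral_damp]
  refine integral_congr_ae (ae_of_all _ fun x => ?_)
  simp only [Real.rpow_neg_one]
  rw [div_eq_inv_mul]

/-! ### Unbounded evaluation at `i` for determinate measures -/

/-- A real polynomial without negative values on `ℝ` is the square of the modulus of a complex
polynomial there. -/
lemma exists_eq_mul_conj_of_nonneg (R : ℝ[X]) (hR : ∀ x, 0 ≤ R.eval x) :
    ∃ P : ℂ[X], R.map Complex.ofRealHom = P * P.map (starRingEnd ℂ) := by
  induction hn : R.natDegree using Nat.strong_induction_on generalizing R with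
  | _ n ih =>
  by_cases hR0 : R = 0
  · exact ⟨0, by simp [hR0]⟩
  rcases Nat.eq_zero_or_pos n with rfl | hpos
  · obtain ⟨c, rfl⟩ := natDegree_eq_zero.1 hn
    have hc : 0 ≤ c := by simpa using hR 0
    refine ⟨C ((√c : ℝ) : ℂ), ?_⟩
    simp only [map_C, Complex.conj_ofReal, Complex.ofRealHom_eq_coe]
    rw [← C_mul, ← Complex.ofReal_mul, Real.mul_self_sqrt hc]
  obtain ⟨z, hz⟩ : ∃ z : ℂ, aeval z R = 0 := by
    refine IsAlgClosed.exists_aeval_eq_zero ℂ R ?_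
    rw [degree_eq_natDegree hR0, hn]; exact_mod_cast hpos.ne'
  by_cases him : z.im = 0
  · obtain ⟨r, rfl⟩ : ∃ r : ℝ, z = r := ⟨z.re, by apply Complex.ext <;> simp [him]⟩
    have hr : R.eval r = 0 := by
      have : ((R.eval r : ℝ) : ℂ) = 0 := by
        rw [← hz]; simpa using (Polynomial.aeval_algebraMap_apply ℂ r R).symm
      exact_mod_cast this
    obtain ⟨R1, rfl⟩ := dvd_iff_isRoot.2 hr
    -- The cofactor changes sign at `r`, so `r` is a double root.
    have hr1 : R1.eval r = 0 := by
      apply le_antisymm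
      · refine le_of_tendsto (R1.continuous.continuousAt.tendsto.mono_left
          (nhdsWithin_le_nhds (s := Set.Iio r))) ?_
        filter_upwards [self_mem_nhdsWithin] with x hx
        have h := hR x
        simp only [eval_mul, eval_sub, eval_X, eval_C] at h
        have : x - r < 0 := sub_neg.2 hx
        nlinarith
      · refine ge_of_tendsto (R1.continuous.continuousAt.tendsto.mono_left
          (nhdsWithin_le_nhds (s := Set.Ioi r))) ?_
        filter_upwards [self_mem_nhdsWithin] with x hx
        have h := hR x
        simp only [eval_mul, eval_sub, eval_X, eval_C] at h
        have : 0 < x - r := sub_pos.2 hx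
        nlinarith
    obtain ⟨S, rfl⟩ := dvd_iff_isRoot.2 hr1
    have hSne : ∀ x, x ≠ r → 0 ≤ S.eval x := fun x hx => by
      have h := hR x
      simp only [eval_mul, eval_sub, eval_X, eval_C] at h
      have : 0 < (x - r) ^ 2 := by
        have := sub_ne_zero.2 hx
        positivity
      nlinarith
    have hS : ∀ x, 0 ≤ S.eval x := fun x => by
      by_cases hx : x = r
      · rw [hx]
        refine ge_of_tendsto (S.continuous.continuousAt.tendsto.mono_left
          (nhdsWithin_le_nhds (s := ({r}ᶜ : Set ℝ)))) ?_
        filter_upwards [self_mem_nhdsWithin] with y hy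
        exact hSne y hy
      · exact hSne x hx
    have hS0 : S ≠ 0 := by rintro rfl; simp at hR0
    have hdeg : S.natDegree < n := by
      rw [natDegree_mul (X_sub_C_ne_zero r) (mul_ne_zero (X_sub_C_ne_zero r) hS0),
        natDegree_mul (X_sub_C_ne_zero r) hS0, natDegree_X_sub_C] at hn
      omega
    obtain ⟨P, hP⟩ := ih _ hdeg S hS rfl
    refine ⟨(X - C (r : ℂ)) * P, ?_⟩
    simp only [Polynomial.map_mul, hP, Polynomial.map_sub, map_X, map_C, Complex.conj_ofReal,
      Complex.ofRealHom_eq_coe]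
    ring
  · obtain ⟨S, rfl⟩ := quadratic_dvd_of_aeval_eq_zero_im_ne_zero R hz him
    have hnorm : ‖z‖ ^ 2 = z.re ^ 2 + z.im ^ 2 := by
      rw [← Complex.normSq_eq_norm_sq, Complex.normSq_apply]; ring
    have hS : ∀ x, 0 ≤ S.eval x := fun x => by
      have h := hR x
      simp only [eval_mul, eval_sub, eval_X, eval_C, eval_add, eval_pow, hnorm] at h
      have : 0 < x ^ 2 - 2 * z.re * x + (z.re ^ 2 + z.im ^ 2) := by
        have h1 : 0 < z.im ^ 2 := by positivity
        nlinarith [sq_nonneg (x - z.re)]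
      exact nonneg_of_mul_nonneg_right h this
    have hS0 : S ≠ 0 := by rintro rfl; simp at hR0
    have hQdeg : (X ^ 2 - C (2 * z.re) * X + C (‖z‖ ^ 2) : ℝ[X]).natDegree = 2 := by
      compute_degree!
    have hdeg : S.natDegree < n := by
      have hQ0 : (X ^ 2 - C (2 * z.re) * X + C (‖z‖ ^ 2) : ℝ[X]) ≠ 0 := by
        intro h; rw [h] at hQdeg; simp at hQdeg
      rw [natDegree_mul hQ0 hS0, hQdeg] at hn
      omega
    obtain ⟨P, hP⟩ := ih _ hdeg S hS rfl
    refine ⟨(X - C z) * P, ?_⟩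
    have hQ : (X ^ 2 - C (2 * z.re) * X + C (‖z‖ ^ 2) : ℝ[X]).map Complex.ofRealHom
        = (X - C z) * (X - C (conj z)) := by
      have h1 : ((2 * z.re : ℝ) : ℂ) = z + conj z := by
        rw [Complex.add_conj]
      have h2 : ((‖z‖ ^ 2 : ℝ) : ℂ) = z * conj z := by
        rw [Complex.mul_conj, Complex.normSq_eq_norm_sq]
      simp only [Polynomial.map_add, Polynomial.map_sub, Polynomial.map_pow, Polynomial.map_mul,
        map_X, map_C, Complex.ofRealHom_eq_coe, h1, h2]
      simp only [C_add, C_mul]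
      ring
    rw [Polynomial.map_mul, hQ, hP]
    simp only [Polynomial.map_mul, Polynomial.map_sub, map_X, map_C]
    ring

lemma norm_sq_ofReal_sub_I (x : ℝ) : ‖(x : ℂ) - Complex.I‖ ^ 2 = 1 + x ^ 2 := by
  rw [← Complex.normSq_eq_norm_sq, Complex.normSq_apply]; simp; ring

lemma norm_sq_ofReal_add_I (x : ℝ) : ‖(x : ℂ) + Complex.I‖ ^ 2 = 1 + x ^ 2 := by
  rw [← Complex.normSq_eq_norm_sq, Complex.normSq_apply]; simp; ring

lemma integrable_div_one_add_sq {μ : Measure ℝ} {f : ℝ → ℝ} (hf : Integrable f μ) :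
    Integrable (fun x => f x / (1 + x ^ 2)) μ := by
  refine hf.mono (hf.1.mul
    (Continuous.aestronglyMeasurable (f := fun x : ℝ => (1 + x ^ 2)⁻¹) ?_)) (ae_of_all _ fun x => ?_)
  · exact Continuous.inv₀ (by fun_prop) fun x => by positivity
  · rw [norm_div]
    refine div_le_self (norm_nonneg _) ?_
    rw [Real.norm_of_nonneg (by positivity)]
    nlinarith [sq_nonneg x]

/-- `∫ |P|² / (1 + x²) dν`. -/
noncomputable def dampedNormSq (ν : Measure ℝ) (P : ℂ[X]) : ℝ :=
  ∫ x : ℝ, ‖P.eval (x : ℂ)‖ ^ 2 / (1 + x ^ 2) ∂ν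

lemma dampedNormSq_nonneg (ν : Measure ℝ) (P : ℂ[X]) : 0 ≤ dampedNormSq ν P :=
  integral_nonneg fun x => by positivity

lemma dampedNormSq_sub_le {ν : Measure ℝ} (hν : ν ∈ MStar) (P Q : ℂ[X]) :
    dampedNormSq ν (P - Q) ≤ 2 * dampedNormSq ν P + 2 * dampedNormSq ν Q := by
  have h (P : ℂ[X]) := integrable_div_one_add_sq (integrable_norm_sq hν P)
  simp only [dampedNormSq]
  rw [← integral_const_mul, ← integral_const_mul, ← integral_add ((h P).const_mul 2)
    ((h Q).const_mul 2)]
  refine integral_mono (h _) (((h P).const_mul 2).add ((h Q).const_mul 2)) fun x => ?_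
  simp only [eval_sub]
  have h1 : ‖P.eval (x : ℂ) - Q.eval (x : ℂ)‖ ^ 2
      ≤ 2 * ‖P.eval (x : ℂ)‖ ^ 2 + 2 * ‖Q.eval (x : ℂ)‖ ^ 2 := by
    have := norm_sub_le (P.eval (x : ℂ)) (Q.eval (x : ℂ))
    nlinarith [norm_nonneg (P.eval (x : ℂ) - Q.eval (x : ℂ)),
      sq_nonneg (‖P.eval (x : ℂ)‖ - ‖Q.eval (x : ℂ)‖)]
  calc _ ≤ (2 * ‖P.eval (x : ℂ)‖ ^ 2 + 2 * ‖Q.eval (x : ℂ)‖ ^ 2) / (1 + x ^ 2) := by gcongr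
    _ = _ := by ring

lemma dampedNormSq_C_mul (ν : Measure ℝ) (a : ℂ) (P : ℂ[X]) :
    dampedNormSq ν (C a * P) = ‖a‖ ^ 2 * dampedNormSq ν P := by
  simp only [dampedNormSq, ← integral_const_mul]
  refine integral_congr_ae (ae_of_all _ fun x => ?_)
  simp only [eval_mul, eval_C, norm_mul]
  ring

lemma dampedNormSq_X_sub_I (ν : Measure ℝ) (S : ℂ[X]) :
    dampedNormSq ν ((X - C Complex.I) * S) = ∫ x : ℝ, ‖S.eval (x : ℂ)‖ ^ 2 ∂ν := by
  refine integral_congr_ae (ae_of_all _ fun x => ?_)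
  have : (1 + x ^ 2 : ℝ) ≠ 0 := by positivity
  simp only [eval_mul, eval_sub, eval_X, eval_C, norm_mul, mul_pow, norm_sq_ofReal_sub_I]
  field_simp

lemma dampedNormSq_X_add_I (ν : Measure ℝ) (S : ℂ[X]) :
    dampedNormSq ν ((X - C (-Complex.I)) * S) = ∫ x : ℝ, ‖S.eval (x : ℂ)‖ ^ 2 ∂ν := by
  refine integral_congr_ae (ae_of_all _ fun x => ?_)
  have : (1 + x ^ 2 : ℝ) ≠ 0 := by positivity
  simp only [eval_mul, eval_sub, eval_X, eval_C, norm_mul, mul_pow, sub_neg_eq_add,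
    norm_sq_ofReal_add_I]
  field_simp

/-- If evaluation at `i` is bounded, the functional `R ↦ ∫ R / (1 + x²) dν` can be perturbed by a
multiple of the evaluation at `i` and stays positive. Otherwise there are, for every direction `w`,
polynomials `P` with `P(i) = 1`, of small damped norm, for which `P(-i)` makes an obtuse angle with
`w`. Boundedness of the evaluation keeps the values `P(-i)` away from `0` and close to each other,
so that they cannot avoid a direction chosen among them. -/
lemma exists_positive_perturbation {ν : Measure ℝ} (hν : ν ∈ MStar)
    (h : EvalBounded ν Complex.I) :
    ∃ w : ℂ, w ≠ 0 ∧ ∀ R : ℝ[X], (∀ x, 0 ≤ R.eval x) →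
      0 ≤ ∫ x, R.eval x / (1 + x ^ 2) ∂ν + (w * aeval Complex.I R).re := by
  obtain ⟨K, hK0, hK⟩ := h.exists_pos
  have hK' (P : ℂ[X]) :
      ‖P.eval (-Complex.I)‖ ^ 2 ≤ K * ∫ x : ℝ, ‖P.eval (x : ℂ)‖ ^ 2 ∂ν := by
    have := hK (P.map (starRingEnd ℂ))
    simpa [eval_map_conj] using this
  have hnear (P Q : ℂ[X]) (hPQ : P.eval Complex.I = Q.eval Complex.I) :
      ‖P.eval (-Complex.I) - Q.eval (-Complex.I)‖ ^ 2
        ≤ 8 * K * (dampedNormSq ν P + dampedNormSq ν Q) := by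
    have h1 := mul_divDiff Complex.I (P - Q)
    simp only [eval_sub, hPQ, sub_self, C_0, add_zero] at h1
    have h2 := eval_eq_divDiff Complex.I (-Complex.I) (P - Q)
    simp only [eval_sub, hPQ, sub_self, zero_add] at h2
    have h3 := dampedNormSq_X_sub_I ν (divDiff Complex.I (P - Q))
    rw [h1] at h3
    have h4 := dampedNormSq_sub_le hν P Q
    have h5 := hK' (divDiff Complex.I (P - Q))
    rw [← h3] at h5
    have h6 : ‖-Complex.I - Complex.I‖ = 2 := by
      rw [show -Complex.I - Complex.I = -2 * Complex.I by ring]; simp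
    rw [h2, norm_mul, mul_pow, h6]
    nlinarith
  have hlow (P : ℂ[X]) : ‖P.eval Complex.I‖ ^ 2
      ≤ (2 + 16 * K * dampedNormSq ν 1) * ‖P.eval (-Complex.I)‖ ^ 2
        + 16 * K * dampedNormSq ν P := by
    have h1 := mul_divDiff (-Complex.I) P
    have h2 := eval_eq_divDiff (-Complex.I) Complex.I P
    have h3 := dampedNormSq_X_add_I ν (divDiff (-Complex.I) P)
    rw [← eq_sub_iff_add_eq] at h1
    rw [h1] at h3
    have h4 := dampedNormSq_sub_le hν P (C (P.eval (-Complex.I)))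
    have h4' := dampedNormSq_C_mul ν (P.eval (-Complex.I)) 1
    rw [mul_one] at h4'
    have h5 := hK (divDiff (-Complex.I) P)
    rw [← h3] at h5
    have h6 : ‖Complex.I - -Complex.I‖ = 2 := by
      rw [show Complex.I - -Complex.I = 2 * Complex.I by ring]; simp
    have h7 : ‖P.eval Complex.I‖ ≤ ‖P.eval (-Complex.I)‖
        + 2 * ‖(divDiff (-Complex.I) P).eval Complex.I‖ := by
      rw [h2]
      refine (norm_add_le _ _).trans ?_
      rw [norm_mul, h6]
    have h8 : ‖P.eval Complex.I‖ ^ 2 ≤ 2 * ‖P.eval (-Complex.I)‖ ^ 2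
        + 8 * ‖(divDiff (-Complex.I) P).eval Complex.I‖ ^ 2 := by
      nlinarith [norm_nonneg (P.eval Complex.I), sq_nonneg (‖P.eval (-Complex.I)‖
        - 2 * ‖(divDiff (-Complex.I) P).eval Complex.I‖)]
    nlinarith
  have hM := dampedNormSq_nonneg ν 1
  set A : ℝ := 2 + 16 * K * dampedNormSq ν 1 with hA
  have hA0 : 0 < A := by positivity
  by_contra! hcon
  have hfail (w : ℂ) (hw : w ≠ 0) : ∃ P : ℂ[X], P.eval Complex.I = 1 ∧
      dampedNormSq ν P + (w * conj (P.eval (-Complex.I))).re < 0 := by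
    obtain ⟨R, hR, hneg⟩ := hcon w hw
    obtain ⟨P, hP⟩ := exists_eq_mul_conj_of_nonneg R hR
    have hI : aeval Complex.I R = P.eval Complex.I * conj (P.eval (-Complex.I)) := by
      have : aeval Complex.I R = (R.map Complex.ofRealHom).eval Complex.I := by
        rw [eval_map]; rfl
      rw [this, hP, eval_mul, eval_map_conj, Complex.conj_I]
    have hx : ∀ x : ℝ, R.eval x = ‖P.eval (x : ℂ)‖ ^ 2 := fun x => by
      have h1 : ((R.eval x : ℝ) : ℂ) = (R.map Complex.ofRealHom).eval (x : ℂ) := by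
        rw [eval_map]; exact (Polynomial.eval₂_at_apply Complex.ofRealHom x).symm
      rw [hP, eval_mul_map_conj] at h1
      exact_mod_cast h1
    simp only [hx, hI] at hneg
    have hne : P.eval Complex.I ≠ 0 := by
      intro h0
      have := dampedNormSq_nonneg ν P
      simp only [h0, zero_mul, mul_zero, Complex.zero_re, add_zero] at hneg
      exact absurd hneg (not_lt.2 this)
    refine ⟨C (P.eval Complex.I)⁻¹ * P, by simp [hne], ?_⟩
    have hpos : 0 < ‖P.eval Complex.I‖ ^ 2 := by positivity
    have key : w * conj ((C (P.eval Complex.I)⁻¹ * P).eval (-Complex.I))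
        = ((‖P.eval Complex.I‖ ^ 2 : ℝ)⁻¹ : ℝ) *
          (w * (P.eval Complex.I * conj (P.eval (-Complex.I)))) := by
      have h1 : (((‖P.eval Complex.I‖ ^ 2 : ℝ)⁻¹ : ℝ) : ℂ)
          = (P.eval Complex.I)⁻¹ * (conj (P.eval Complex.I))⁻¹ := by
        rw [Complex.ofReal_inv, ← Complex.normSq_eq_norm_sq, ← Complex.mul_conj, mul_inv]
      rw [h1]
      simp only [eval_mul, eval_C, map_mul, map_inv₀]
      field_simp
    rw [dampedNormSq_C_mul, key, Complex.re_ofReal_mul, norm_inv, inv_pow, ← mul_add]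
    exact mul_neg_of_pos_of_neg (inv_pos.2 hpos) hneg
  -- The two failing directions below force `|P₀(-i)| + |P₁(-i)| ≤ η`, too small for `P(i) = 1`.
  set η : ℝ := 1 / (A + 2) with hη
  have hη0 : 0 < η := by positivity
  set δ : ℝ := η / (16 * K) with hδ
  have hδ0 : 0 < δ := by positivity
  have hδK : 16 * K * δ = η := by rw [hδ]; field_simp
  obtain ⟨P0, hP0, hN0⟩ := hfail (δ : ℂ) (by exact_mod_cast hδ0.ne')
  set b0 := P0.eval (-Complex.I)
  have hb0 : dampedNormSq ν P0 < δ * ‖b0‖ := by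
    have h1 := Complex.abs_re_le_norm b0
    have h2 : ((δ : ℂ) * conj b0).re = δ * b0.re := by simp
    rw [h2] at hN0
    nlinarith [neg_abs_le b0.re]
  have hb0pos : 0 < ‖b0‖ := by
    by_contra h0
    have := dampedNormSq_nonneg ν P0
    nlinarith
  obtain ⟨P1, hP1, hN1⟩ := hfail (((δ / ‖b0‖ : ℝ) : ℂ) * b0)
    (mul_ne_zero (by exact_mod_cast (by positivity : δ / ‖b0‖ ≠ 0)) (norm_pos_iff.1 hb0pos))
  set b1 := P1.eval (-Complex.I)
  rw [mul_assoc, Complex.re_ofReal_mul] at hN1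
  have hN1' := dampedNormSq_nonneg ν P1
  have hc0 : 0 < δ / ‖b0‖ := by positivity
  have hre : (b0 * conj b1).re < 0 := by
    by_contra h0
    nlinarith [mul_nonneg hc0.le (not_lt.1 h0)]
  have hb1 : dampedNormSq ν P1 < δ * ‖b1‖ := by
    have h1 := Complex.abs_re_le_norm (b0 * conj b1)
    rw [norm_mul, Complex.norm_conj] at h1
    have h2 : δ / ‖b0‖ * (‖b0‖ * ‖b1‖) = δ * ‖b1‖ := by field_simp
    have h3 := mul_le_mul_of_nonneg_left ((neg_le_abs _).trans h1) hc0.le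
    linarith
  have hsq : ‖b1 - b0‖ ^ 2 = ‖b1‖ ^ 2 + ‖b0‖ ^ 2 - 2 * (b0 * conj b1).re := by
    simp only [← Complex.normSq_eq_norm_sq, Complex.normSq_apply, Complex.sub_re, Complex.sub_im,
      Complex.mul_re, Complex.conj_re, Complex.conj_im]
    ring
  have hd := hnear P1 P0 (hP1.trans hP0.symm)
  have hx1 := norm_nonneg b1
  have hsum : ‖b0‖ + ‖b1‖ ≤ η := by
    have h1 : (‖b0‖ + ‖b1‖) ^ 2 ≤ η * (‖b0‖ + ‖b1‖) := by
      have h2 : 8 * K * (dampedNormSq ν P1 + dampedNormSq ν P0)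
          ≤ 8 * K * (δ * ‖b1‖ + δ * ‖b0‖) := by gcongr
      have h3 : 8 * K * (δ * ‖b1‖ + δ * ‖b0‖) = η / 2 * (‖b0‖ + ‖b1‖) := by
        rw [← hδK]; ring
      nlinarith [sq_nonneg (‖b0‖ - ‖b1‖)]
    by_contra! h2
    nlinarith
  have hl := hlow P0
  rw [hP0, norm_one] at hl
  have h1 : ‖b0‖ ≤ η := by linarith
  have h2 : 16 * K * dampedNormSq ν P0 ≤ η * η := by
    calc 16 * K * dampedNormSq ν P0 ≤ 16 * K * (δ * ‖b0‖) := by gcongr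
      _ = η * ‖b0‖ := by rw [← hδK]; ring
      _ ≤ η * η := by gcongr
  have h3 : A * ‖b0‖ ^ 2 ≤ A * η ^ 2 := by gcongr
  have h4 : (A + 2) * η = 1 := by rw [hη]; field_simp
  have h5 : η < 1 := by
    rw [hη, div_lt_one (by positivity)]; linarith
  nlinarith

/-! ### Positive functionals on functions of polynomial growth -/

/-- The continuous functions on `ℝ` of at most polynomial growth. -/
def polyGrowth : Submodule ℝ (ℝ → ℝ) where
  carrier := {f | Continuous f ∧ ∃ (n : ℕ) (c : ℝ), ∀ x, |f x| ≤ c * (1 + x ^ 2) ^ n}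
  zero_mem' := ⟨continuous_const, 0, 0, fun x => by simp⟩
  add_mem' := by
    rintro f g ⟨hf, n, c, hc⟩ ⟨hg, m, d, hd⟩
    refine ⟨hf.add hg, n + m, |c| + |d|, fun x => ?_⟩
    have h1 : (1 : ℝ) ≤ 1 + x ^ 2 := by nlinarith [sq_nonneg x]
    have hn : (1 + x ^ 2 : ℝ) ^ n ≤ (1 + x ^ 2) ^ (n + m) := pow_le_pow_right₀ h1 (by omega)
    have hm : (1 + x ^ 2 : ℝ) ^ m ≤ (1 + x ^ 2) ^ (n + m) := pow_le_pow_right₀ h1 (by omega)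
    calc |f x + g x| ≤ |f x| + |g x| := abs_add_le _ _
      _ ≤ c * (1 + x ^ 2) ^ n + d * (1 + x ^ 2) ^ m := add_le_add (hc x) (hd x)
      _ ≤ |c| * (1 + x ^ 2) ^ n + |d| * (1 + x ^ 2) ^ m := by
        gcongr <;> exact le_abs_self _
      _ ≤ |c| * (1 + x ^ 2) ^ (n + m) + |d| * (1 + x ^ 2) ^ (n + m) := by gcongr
      _ = _ := by ring
  smul_mem' := by
    rintro a f ⟨hf, n, c, hc⟩
    refine ⟨hf.const_smul a, n, |a| * c, fun x => ?_⟩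
    simp only [Pi.smul_apply, smul_eq_mul, abs_mul, mul_assoc]
    exact mul_le_mul_of_nonneg_left (hc x) (abs_nonneg a)

lemma one_add_sq_pow_mem_polyGrowth (n : ℕ) : (fun x : ℝ => (1 + x ^ 2) ^ n) ∈ polyGrowth :=
  ⟨by fun_prop, n, 1, fun x => by rw [one_mul, abs_of_nonneg (by positivity)]⟩

lemma mul_mem_polyGrowth {f χ : ℝ → ℝ} (hf : f ∈ polyGrowth) (hχ : Continuous χ)
    (h : ∀ x, |χ x| ≤ 1) : (fun x => f x * χ x) ∈ polyGrowth := by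
  obtain ⟨hc, n, c, hn⟩ := hf
  refine ⟨hc.mul hχ, n, c, fun x => ?_⟩
  rw [abs_mul]
  exact (mul_le_of_le_one_right (abs_nonneg _) (h x)).trans (hn x)

lemma eval_mem_polyGrowth (P : ℝ[X]) : (fun x => P.eval x) ∈ polyGrowth := by
  induction P using Polynomial.induction_on' with
  | add p q hp hq =>
    have h : (fun x => (p + q).eval x) = (fun x => p.eval x) + fun x => q.eval x := by
      funext x; simp
    rw [h]
    exact polyGrowth.add_mem hp hq
  | monomial n a =>
    refine ⟨by fun_prop, n, |a|, fun x => ?_⟩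
    simp only [eval_monomial, abs_mul, abs_pow]
    gcongr
    nlinarith [sq_nonneg (|x| - 1), sq_abs x, abs_nonneg x]

/-- A continuous cutoff: `1` on `[-N, N]` and `0` outside `[-N - 1, N + 1]`. -/
noncomputable def cutoff (N : ℕ) (x : ℝ) : ℝ := max 0 (min 1 (N + 1 - |x|))

lemma continuous_cutoff (N : ℕ) : Continuous (cutoff N) := by unfold cutoff; fun_prop

lemma cutoff_nonneg (N : ℕ) (x : ℝ) : 0 ≤ cutoff N x := le_max_left _ _

lemma cutoff_le_one (N : ℕ) (x : ℝ) : cutoff N x ≤ 1 :=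
  max_le zero_le_one (min_le_left _ _)

lemma cutoff_eq_one {N : ℕ} {x : ℝ} (h : |x| ≤ N) : cutoff N x = 1 := by
  unfold cutoff
  rw [min_eq_left (by linarith), max_eq_right zero_le_one]

lemma cutoff_eq_zero {N : ℕ} {x : ℝ} (h : (N : ℝ) + 1 < |x|) : cutoff N x = 0 := by
  unfold cutoff
  exact max_eq_left ((min_le_right _ _).trans (by linarith))

lemma cutoff_mono (x : ℝ) : Monotone fun N => cutoff N x := by
  intro N M h
  have : (N : ℝ) ≤ M := by exact_mod_cast h
  change max 0 (min 1 ((N : ℝ) + 1 - |x|)) ≤ max 0 (min 1 ((M : ℝ) + 1 - |x|))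
  gcongr

lemma tendsto_cutoff (x : ℝ) : Tendsto (fun N => cutoff N x) atTop (𝓝 1) := by
  refine tendsto_const_nhds.congr' ?_
  filter_upwards [eventually_ge_atTop ⌈|x|⌉₊] with N hN
  exact (cutoff_eq_one (Nat.ceil_le.1 hN)).symm

lemma hasCompactSupport_mul_cutoff (f : ℝ → ℝ) (N : ℕ) :
    HasCompactSupport fun x => f x * cutoff N x := by
  refine HasCompactSupport.intro (isCompact_Icc (a := -((N : ℝ) + 1)) (b := N + 1)) fun x hx => ?_
  have : (N : ℝ) + 1 < |x| := by
    by_contra! h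
    exact hx ⟨by linarith [neg_le_of_abs_le h], le_of_abs_le h⟩
  rw [cutoff_eq_zero this, mul_zero]

open CompactlySupported in
/-- A positive functional on the continuous functions of polynomial growth is integration against
a measure. Domination by `(1 + x²)^(n+1)` keeps mass from escaping to infinity when the
representation on compactly supported functions is extended. -/
lemma exists_measure_of_positive (g : polyGrowth →ₗ[ℝ] ℝ)
    (hg : ∀ f : polyGrowth, (∀ x, 0 ≤ f.1 x) → 0 ≤ g f) :
    ∃ τ : Measure ℝ, ∀ f : polyGrowth, Integrable f.1 τ ∧ ∫ x, f.1 x ∂τ = g f := by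
  have hmem (f : C_c(ℝ, ℝ)) : (f : ℝ → ℝ) ∈ polyGrowth := by
    obtain ⟨c, hc⟩ := f.hasCompactSupport.exists_bound_of_continuous f.continuous
    exact ⟨f.continuous, 0, c, fun x => by simpa using hc x⟩
  let Λ : C_c(ℝ, ℝ) →ₚ[ℝ] ℝ := PositiveLinearMap.mk₀
    { toFun := fun f => g ⟨f, hmem f⟩
      map_add' := fun a b => by rw [← map_add]; rfl
      map_smul' := fun a b => by rw [RingHom.id_apply, ← map_smul]; rfl }
    fun f hf => hg _ fun x => hf x
  have hmono (f h : polyGrowth) (hfh : ∀ x, f.1 x ≤ h.1 x) : g f ≤ g h := by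
    have := hg (h - f) fun x => sub_nonneg.2 (hfh x)
    rw [map_sub] at this; linarith
  let τ := RealRMK.rieszMeasure Λ
  have hτ (f : C_c(ℝ, ℝ)) : ∫ x, f x ∂τ = g ⟨f, hmem f⟩ := RealRMK.integral_rieszMeasure Λ f
  have hpos (f : polyGrowth) (hf : ∀ x, 0 ≤ f.1 x) :
      Integrable f.1 τ ∧ ∫ x, f.1 x ∂τ = g f := by
    obtain ⟨f, hfm⟩ := f
    simp only at hf ⊢
    obtain ⟨hfc, n, c, hc⟩ := id hfm
    have hc0 : 0 ≤ c := by
      have := (abs_nonneg _).trans (hc 0)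
      simpa using this
    let u (N : ℕ) : C_c(ℝ, ℝ) :=
      ⟨⟨fun x => f x * cutoff N x, hfc.mul (continuous_cutoff N)⟩, hasCompactSupport_mul_cutoff f N⟩
    have hu (N : ℕ) (x : ℝ) : u N x = f x * cutoff N x := rfl
    have hlim : Tendsto (fun N => g ⟨u N, hmem (u N)⟩) atTop (𝓝 (g ⟨f, hfm⟩)) := by
      have hle (N : ℕ) : g ⟨u N, hmem (u N)⟩ ≤ g ⟨f, hfm⟩ := hmono _ _ fun x => by
        simp only [hu]
        exact mul_le_of_le_one_right (hf x) (cutoff_le_one N x)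
      have hge (N : ℕ) : g ⟨f, hfm⟩ - c / (1 + (N : ℝ) ^ 2) *
          g ⟨_, one_add_sq_pow_mem_polyGrowth (n + 1)⟩ ≤ g ⟨u N, hmem (u N)⟩ := by
        rw [← smul_eq_mul, ← map_smul, ← map_sub]
        refine hmono _ _ fun x => ?_
        simp only [hu, Submodule.coe_sub, Submodule.coe_smul, Pi.sub_apply, Pi.smul_apply,
          smul_eq_mul]
        by_cases hx : |x| ≤ N
        · rw [cutoff_eq_one hx, mul_one]
          have : 0 ≤ c / (1 + (N : ℝ) ^ 2) * (1 + x ^ 2) ^ (n + 1) := by positivity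
          linarith
        · have h1 : f x ≤ c / (1 + (N : ℝ) ^ 2) * (1 + x ^ 2) ^ (n + 1) := by
            have h2 : (N : ℝ) ^ 2 ≤ x ^ 2 := by
              rw [← sq_abs x]; push Not at hx; gcongr
            calc f x ≤ c * (1 + x ^ 2) ^ n := (le_abs_self _).trans (hc x)
              _ = c / (1 + (N : ℝ) ^ 2) * ((1 + x ^ 2) ^ n * (1 + (N : ℝ) ^ 2)) := by
                field_simp
              _ ≤ c / (1 + (N : ℝ) ^ 2) * ((1 + x ^ 2) ^ n * (1 + x ^ 2)) := by gcongr
              _ = _ := by ring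
          have h3 := mul_nonneg (hf x) (cutoff_nonneg N x)
          linarith
      refine tendsto_of_tendsto_of_tendsto_of_le_of_le ?_ tendsto_const_nhds hge hle
      have h0 : Tendsto (fun N : ℕ => c / (1 + (N : ℝ) ^ 2)) atTop (𝓝 0) :=
        tendsto_const_nhds.div_atTop (tendsto_atTop_add_const_left _ _
          ((tendsto_pow_atTop two_ne_zero).comp tendsto_natCast_atTop_atTop))
      simpa using (tendsto_const_nhds (x := g ⟨f, hfm⟩)).sub (h0.mul_const _)
    have huint (N : ℕ) : Integrable (fun x => u N x) τ :=
      (u N).continuous.integrable_of_hasCompactSupport (u N).hasCompactSupport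
    have hu0 (N : ℕ) (x : ℝ) : 0 ≤ u N x := mul_nonneg (hf x) (cutoff_nonneg N x)
    have hlint : ∫⁻ x, ENNReal.ofReal (f x) ∂τ = ENNReal.ofReal (g ⟨f, hfm⟩) := by
      have h1 : Tendsto (fun N => ∫⁻ x, ENNReal.ofReal (u N x) ∂τ) atTop
          (𝓝 (∫⁻ x, ENNReal.ofReal (f x) ∂τ)) := by
        refine lintegral_tendsto_of_tendsto_of_monotone
          (fun N => (u N).continuous.measurable.ennreal_ofReal.aemeasurable)
          (ae_of_all _ fun x N M h => ?_) (ae_of_all _ fun x => ?_)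
        · exact ENNReal.ofReal_le_ofReal (mul_le_mul_of_nonneg_left (cutoff_mono x h) (hf x))
        · refine ENNReal.tendsto_ofReal ?_
          simpa only [hu, mul_one] using (tendsto_cutoff x).const_mul (f x)
      refine tendsto_nhds_unique h1 ?_
      refine (ENNReal.tendsto_ofReal hlim).congr fun N => ?_
      rw [← hτ, ofReal_integral_eq_lintegral_ofReal (huint N) (ae_of_all _ (hu0 N))]
    have hint : Integrable f τ := by
      refine ⟨hfc.aestronglyMeasurable, ?_⟩
      rw [hasFiniteIntegral_iff_ofReal (ae_of_all _ hf), hlint]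
      exact ENNReal.ofReal_lt_top
    refine ⟨hint, ?_⟩
    rw [integral_eq_lintegral_of_nonneg_ae (ae_of_all _ hf) hint.1, hlint,
      ENNReal.toReal_ofReal (hg _ hf)]
  refine ⟨τ, fun f => ?_⟩
  obtain ⟨f, hfm⟩ := f
  obtain ⟨hfc, n, c, hc⟩ := id hfm
  let B : polyGrowth := c • ⟨_, one_add_sq_pow_mem_polyGrowth n⟩
  have hB (x : ℝ) : B.1 x = c * (1 + x ^ 2) ^ n := rfl
  obtain ⟨hi1, he1⟩ := hpos (⟨f, hfm⟩ + B) fun x => by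
    simp only [Submodule.coe_add, Pi.add_apply, hB]
    linarith [neg_le_of_abs_le (hc x)]
  obtain ⟨hi2, he2⟩ := hpos B fun x => (abs_nonneg _).trans (hc x)
  have hfe : f = fun x => (⟨f, hfm⟩ + B : polyGrowth).1 x - B.1 x := by
    funext x; simp
  constructor
  · simp only
    rw [hfe]; exact hi1.sub hi2
  · calc ∫ x, f x ∂τ = ∫ x, ((⟨f, hfm⟩ + B : polyGrowth).1 x - B.1 x) ∂τ := by rw [← hfe]
      _ = _ := by rw [integral_sub hi1 hi2, he1, he2, map_add, add_sub_cancel_right]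

/-- The function `R / (1 + x²)`, for a polynomial `R`. -/
noncomputable def divOneAddSq : ℝ[X] →ₗ[ℝ] polyGrowth where
  toFun R := ⟨fun x => R.eval x * (1 + x ^ 2)⁻¹, mul_mem_polyGrowth (eval_mem_polyGrowth R)
    (Continuous.inv₀ (by fun_prop) fun x => by positivity) fun x => by
      rw [abs_of_nonneg (by positivity)]
      exact inv_le_one_of_one_le₀ (by nlinarith [sq_nonneg x])⟩
  map_add' P Q := by ext x; simp [add_mul]
  map_smul' a P := by ext x; simp [mul_assoc]

lemma divOneAddSq_apply (R : ℝ[X]) (x : ℝ) : (divOneAddSq R).1 x = R.eval x / (1 + x ^ 2) := rfl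

lemma divOneAddSq_injective : Function.Injective divOneAddSq := by
  intro P Q h
  refine Polynomial.funext fun x => ?_
  have h1 := congrFun (congrArg Subtype.val h) x
  have : (1 + x ^ 2 : ℝ) ≠ 0 := by positivity
  rw [divOneAddSq_apply, divOneAddSq_apply] at h1
  field_simp at h1
  exact h1

lemma divOneAddSq_mul (P : ℝ[X]) (x : ℝ) :
    (divOneAddSq (P * (1 + X ^ 2))).1 x = P.eval x := by
  have : (1 + x ^ 2 : ℝ) ≠ 0 := by positivity
  rw [divOneAddSq_apply]
  simp [this]

/-- A measure of infinite support for which evaluation at `i` is bounded shares its moments with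
another measure. A perturbation of the functional `R ↦ ∫ R / (1 + x²) dν` by a multiple of `R(i)`
leaves the moments unchanged, and the M. Riesz extension theorem provides a measure that represents
it. -/
theorem exists_ne_of_evalBounded {ν : Measure ℝ} (hν : ν ∈ MStar) (h : EvalBounded ν Complex.I) :
    ∃ τ ∈ solutions ν, τ ≠ ν := by
  obtain ⟨w, hw, hpos⟩ := exists_positive_perturbation hν h
  have hint (R : ℝ[X]) : Integrable (fun x => R.eval x / (1 + x ^ 2)) ν :=
    integrable_div_one_add_sq (integrable_eval hν R)
  let l : ℝ[X] →ₗ[ℝ] ℝ :=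
    { toFun := fun R => ∫ x, R.eval x / (1 + x ^ 2) ∂ν + (w * aeval Complex.I R).re
      map_add' := fun P Q => by
        have : ∫ x, (P + Q).eval x / (1 + x ^ 2) ∂ν
            = ∫ x, P.eval x / (1 + x ^ 2) ∂ν + ∫ x, Q.eval x / (1 + x ^ 2) ∂ν := by
          rw [← integral_add (hint P) (hint Q)]
          simp only [eval_add, add_div]
        rw [this, map_add, mul_add, Complex.add_re]
        ring
      map_smul' := fun a P => by
        have : ∫ x, (a • P).eval x / (1 + x ^ 2) ∂ν = a * ∫ x, P.eval x / (1 + x ^ 2) ∂ν := by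
          rw [← integral_const_mul]
          simp only [eval_smul, smul_eq_mul, mul_div_assoc]
        rw [this, map_smul, mul_smul_comm, Complex.smul_re, RingHom.id_apply, smul_eq_mul,
          smul_eq_mul, mul_add] }
  have hl (R : ℝ[X]) : l R = ∫ x, R.eval x / (1 + x ^ 2) ∂ν + (w * aeval Complex.I R).re := rfl
  let e := LinearEquiv.ofInjective divOneAddSq divOneAddSq_injective
  let f : polyGrowth →ₗ.[ℝ] ℝ := ⟨LinearMap.range divOneAddSq, l ∘ₗ e.symm.toLinearMap⟩
  let s : PointedCone ℝ polyGrowth :=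
    { carrier := {f | ∀ x, 0 ≤ f.1 x}
      zero_mem' := fun x => le_rfl
      add_mem' := fun ha hb x => add_nonneg (ha x) (hb x)
      smul_mem' := fun c f hf x => mul_nonneg c.2 (hf x) }
  have hfe (R : ℝ[X]) : f (e R) = l R := by
    change l (e.symm (e R)) = l R
    rw [LinearEquiv.symm_apply_apply]
  obtain ⟨g, hgf, hgs⟩ := riesz_extension s f
    (fun y hy => by
      obtain ⟨R, rfl⟩ := e.surjective y
      rw [hfe, hl]
      refine hpos R fun x => ?_
      have h1 : 0 ≤ (divOneAddSq R).1 x := hy x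
      rw [divOneAddSq_apply] at h1
      have : (0 : ℝ) < 1 + x ^ 2 := by positivity
      have h2 := mul_nonneg h1 this.le
      rwa [div_mul_cancel₀ _ this.ne'] at h2)
    (fun y => by
      obtain ⟨hyc, n, c, hc⟩ := y.2
      refine ⟨e ((C c * (1 + X ^ 2) ^ n) * (1 + X ^ 2)), fun x => ?_⟩
      change 0 ≤ (divOneAddSq ((C c * (1 + X ^ 2) ^ n) * (1 + X ^ 2))).1 x + y.1 x
      rw [divOneAddSq_mul]
      simp only [eval_mul, eval_C, eval_pow, eval_add, eval_one, eval_X]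
      linarith [neg_le_of_abs_le (hc x)])
  have hgR (R : ℝ[X]) : g (divOneAddSq R) = l R := by
    rw [← hfe R, ← hgf (e R)]; rfl
  obtain ⟨τ, hτ⟩ := exists_measure_of_positive g fun f hf => hgs f hf
  have hτP (P : ℝ[X]) : Integrable (fun x => P.eval x) τ ∧ ∫ x, P.eval x ∂τ = ∫ x, P.eval x ∂ν := by
    obtain ⟨h1, h2⟩ := hτ (divOneAddSq (P * (1 + X ^ 2)))
    have h3 : (divOneAddSq (P * (1 + X ^ 2))).1 = fun x => P.eval x :=
      funext fun x => divOneAddSq_mul P x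
    have h4 : ∫ x, (P * (1 + X ^ 2)).eval x / (1 + x ^ 2) ∂ν = ∫ x, P.eval x ∂ν := by
      simp only [← divOneAddSq_apply, divOneAddSq_mul]
    rw [h3] at h1 h2
    refine ⟨h1, ?_⟩
    rw [h2, hgR, hl, h4]
    simp
  have hτR (R : ℝ[X]) : ∫ x, R.eval x / (1 + x ^ 2) ∂τ
      = ∫ x, R.eval x / (1 + x ^ 2) ∂ν + (w * aeval Complex.I R).re := by
    rw [← hl, ← hgR, ← (hτ (divOneAddSq R)).2]; rfl
  refine ⟨τ, ⟨⟨fun hfin => ?_, fun n => ?_⟩, fun n => ?_⟩, ?_⟩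
  · -- A polynomial vanishing on a finite support would have norm `0` for `ν` as well.
    let P : ℝ[X] := ∏ a ∈ hfin.toFinset, (X - C a)
    have hP : P ≠ 0 := Finset.prod_ne_zero_iff.2 fun a _ => X_sub_C_ne_zero a
    have h1 := integral_sq_pos hν hP
    have h2 : ∫ x, P.eval x ^ 2 ∂τ = 0 := by
      refine integral_eq_zero_of_ae ?_
      filter_upwards [Measure.support_mem_ae (μ := τ)] with x hx
      have : P.eval x = 0 := by
        rw [eval_prod]
        exact Finset.prod_eq_zero (hfin.mem_toFinset.2 hx) (by simp)
      simp [this]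
    have h3 := (hτP (P ^ 2)).2
    simp only [eval_pow] at h3
    linarith
  · simpa using (hτP (X ^ n)).1
  · simpa [moment] using (hτP (X ^ n)).2
  · rintro rfl
    apply hw
    have h1 := hτR 1
    have h2 := hτR X
    apply Complex.ext
    · simpa using h1
    · simpa using h2

/-! ### Determinacy from unbounded evaluations -/

lemma ofReal_sub_ne_zero {z : ℂ} (hz : z.im ≠ 0) (x : ℝ) : (x : ℂ) - z ≠ 0 := by
  intro h
  have := congrArg Complex.im h
  simp at this
  exact hz this

lemma abs_im_le_norm_ofReal_sub (z : ℂ) (x : ℝ) : |z.im| ≤ ‖(x : ℂ) - z‖ := by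
  have := Complex.abs_im_le_norm ((x : ℂ) - z)
  simpa using this

lemma norm_cauchyKernel_le {z : ℂ} (hz : z.im ≠ 0) (x : ℝ) :
    ‖1 / ((x : ℂ) - z)‖ ≤ 1 / |z.im| := by
  rw [norm_div, norm_one]
  exact one_div_le_one_div_of_le (abs_pos.2 hz) (abs_im_le_norm_ofReal_sub z x)

lemma continuous_cauchyKernel {z : ℂ} (hz : z.im ≠ 0) :
    Continuous fun x : ℝ => 1 / ((x : ℂ) - z) :=
  continuous_const.div (by fun_prop) (ofReal_sub_ne_zero hz)

/-- The Cauchy kernel `x ↦ 1 / (x - z)` as a bounded continuous function; the second argument is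
the proof that `z` is not real. -/
noncomputable def cauchyKernel (z : ℂ) (hz : z.im ≠ 0) : BoundedContinuousFunction ℝ ℂ :=
  BoundedContinuousFunction.ofNormedAddCommGroup (fun x : ℝ => 1 / ((x : ℂ) - z))
    (continuous_cauchyKernel hz) (1 / |z.im|) (norm_cauchyKernel_le hz)

lemma cauchyKernel_apply {z : ℂ} (hz : z.im ≠ 0) (x : ℝ) :
    cauchyKernel z hz x = 1 / ((x : ℂ) - z) := rfl

lemma integrable_cauchyKernel {μ : Measure ℝ} [IsFiniteMeasure μ] {z : ℂ} (hz : z.im ≠ 0) :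
    Integrable (fun x : ℝ => 1 / ((x : ℂ) - z)) μ :=
  (cauchyKernel z hz).integrable μ

/-- The closed linear span of the constants and the Cauchy kernels. -/
noncomputable def cauchySpan : Submodule ℂ (BoundedContinuousFunction ℝ ℂ) :=
  (Submodule.span ℂ ({1} ∪ Set.range fun z : {z : ℂ // z.im ≠ 0} =>
    cauchyKernel z.1 z.2)).topologicalClosure

lemma one_mem_cauchySpan : 1 ∈ cauchySpan :=
  Submodule.le_topologicalClosure _ (Submodule.subset_span (Or.inl rfl))

lemma cauchyKernel_mem_cauchySpan {z : ℂ} (hz : z.im ≠ 0) : cauchyKernel z hz ∈ cauchySpan :=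
  Submodule.le_topologicalClosure _ (Submodule.subset_span (Or.inr ⟨⟨z, hz⟩, rfl⟩))

/-- To show that a closed subspace contains `cauchySpan` it is enough to look at the generators. -/
lemma cauchySpan_le {W : Submodule ℂ (BoundedContinuousFunction ℝ ℂ)}
    (hW : IsClosed (W : Set (BoundedContinuousFunction ℝ ℂ))) (h1 : 1 ∈ W)
    (hz : ∀ z (hz : z.im ≠ 0), cauchyKernel z hz ∈ W) : cauchySpan ≤ W := by
  refine Submodule.topologicalClosure_minimal _ (Submodule.span_le.2 ?_) hW
  rintro _ (rfl | ⟨⟨z, h⟩, rfl⟩)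
  · exact h1
  · exact hz z h

lemma cauchyKernel_mul_of_ne {z w : ℂ} (hz : z.im ≠ 0) (hw : w.im ≠ 0) (h : z ≠ w) :
    cauchyKernel z hz * cauchyKernel w hw
      = (z - w)⁻¹ • (cauchyKernel z hz - cauchyKernel w hw) := by
  ext x
  have h1 := ofReal_sub_ne_zero hz x
  have h2 := ofReal_sub_ne_zero hw x
  have h3 := sub_ne_zero.2 h
  simp only [BoundedContinuousFunction.coe_mul, Pi.mul_apply, cauchyKernel_apply,
    BoundedContinuousFunction.coe_smul, BoundedContinuousFunction.coe_sub, Pi.sub_apply,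
    smul_eq_mul]
  field_simp
  ring

lemma cauchyKernel_mul_mem {z w : ℂ} (hz : z.im ≠ 0) (hw : w.im ≠ 0) :
    cauchyKernel z hz * cauchyKernel w hw ∈ cauchySpan := by
  have hne {u : ℂ} (hu : u.im ≠ 0) (h : z ≠ u) :
      cauchyKernel z hz * cauchyKernel u hu ∈ cauchySpan := by
    rw [cauchyKernel_mul_of_ne hz hu h]
    exact cauchySpan.smul_mem _ (cauchySpan.sub_mem (cauchyKernel_mem_cauchySpan hz)
      (cauchyKernel_mem_cauchySpan hu))
  by_cases h : z = w
  · subst h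
    -- The double pole is a limit of products of kernels with distinct poles.
    let u (n : ℕ) : ℂ := z + ((z.im * (1 / ((n : ℝ) + 1)) : ℝ) : ℂ) * Complex.I
    have huim (n : ℕ) : (u n).im = z.im * (1 + 1 / ((n : ℝ) + 1)) := by
      simp only [u, Complex.add_im, Complex.im_ofReal_mul, Complex.I_im]; ring
    have hfac (n : ℕ) : (1 : ℝ) ≤ 1 + 1 / ((n : ℝ) + 1) := by
      have : 0 ≤ 1 / ((n : ℝ) + 1) := by positivity
      linarith
    have hu (n : ℕ) : (u n).im ≠ 0 := by
      rw [huim]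
      exact mul_ne_zero hz (by linarith [hfac n])
    have hsub (n : ℕ) : u n - z = ((z.im * (1 / ((n : ℝ) + 1)) : ℝ) : ℂ) * Complex.I := by
      simp [u]
    have hnorm (n : ℕ) : ‖u n - z‖ = |z.im| * (1 / ((n : ℝ) + 1)) := by
      rw [hsub, norm_mul, Complex.norm_I, mul_one, Complex.norm_real, Real.norm_eq_abs, abs_mul,
        abs_of_nonneg (by positivity : 0 ≤ 1 / ((n : ℝ) + 1))]
    have hlim : Tendsto (fun n => cauchyKernel (u n) (hu n)) atTop (𝓝 (cauchyKernel z hz)) := by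
      rw [tendsto_iff_norm_sub_tendsto_zero]
      refine squeeze_zero (fun n => norm_nonneg _) (g := fun n : ℕ => 1 / |z.im| *
        (1 / ((n : ℝ) + 1))) (fun n => ?_) ?_
      · refine (BoundedContinuousFunction.norm_le (by positivity)).2 fun x => ?_
        have h1 := ofReal_sub_ne_zero hz x
        have h2 := ofReal_sub_ne_zero (hu n) x
        have h3 : (cauchyKernel (u n) (hu n) - cauchyKernel z hz) x
            = (u n - z) * ((1 / ((x : ℂ) - u n)) * (1 / ((x : ℂ) - z))) := by
          rw [BoundedContinuousFunction.coe_sub, Pi.sub_apply, cauchyKernel_apply,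
            cauchyKernel_apply]
          field_simp
          ring
        have h4 : 1 / |(u n).im| ≤ 1 / |z.im| := by
          refine one_div_le_one_div_of_le (abs_pos.2 hz) ?_
          rw [huim, abs_mul, abs_of_nonneg (by linarith [hfac n] : 0 ≤ 1 + 1 / ((n : ℝ) + 1))]
          exact le_mul_of_one_le_right (abs_nonneg _) (hfac n)
        rw [h3, norm_mul, norm_mul, hnorm]
        calc |z.im| * (1 / ((n : ℝ) + 1)) * (‖1 / ((x : ℂ) - u n)‖ * ‖1 / ((x : ℂ) - z)‖)
            ≤ |z.im| * (1 / ((n : ℝ) + 1)) * (1 / |z.im| * (1 / |z.im|)) := by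
              gcongr
              · exact (norm_cauchyKernel_le (hu n) x).trans h4
              · exact norm_cauchyKernel_le hz x
          _ = 1 / |z.im| * (1 / ((n : ℝ) + 1)) := by
              have := abs_ne_zero.2 hz
              field_simp
      · simpa using tendsto_one_div_add_atTop_nhds_zero_nat.const_mul (1 / |z.im|)
    refine (Submodule.isClosed_topologicalClosure _).mem_of_tendsto (hlim.const_mul _)
      (Eventually.of_forall fun n => hne (hu n) fun h => ?_)
    have h5 := hnorm n
    rw [← h, sub_self, norm_zero] at h5
    have : 0 < |z.im| * (1 / ((n : ℝ) + 1)) := by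
      have := abs_pos.2 hz
      positivity
    linarith
  · exact hne hw h

lemma mul_mem_cauchySpan {f g : BoundedContinuousFunction ℝ ℂ} (hf : f ∈ cauchySpan)
    (hg : g ∈ cauchySpan) : f * g ∈ cauchySpan := by
  have hcl : IsClosed (cauchySpan : Set (BoundedContinuousFunction ℝ ℂ)) :=
    Submodule.isClosed_topologicalClosure _
  have hclosed (h : BoundedContinuousFunction ℝ ℂ) : IsClosed
      (cauchySpan.comap (LinearMap.mulLeft ℂ h) : Set (BoundedContinuousFunction ℝ ℂ)) :=
    hcl.preimage (continuous_const.mul continuous_id)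
  have hk {z : ℂ} (hz : z.im ≠ 0) {g : BoundedContinuousFunction ℝ ℂ} (hg : g ∈ cauchySpan) :
      cauchyKernel z hz * g ∈ cauchySpan := by
    refine cauchySpan_le (hclosed (cauchyKernel z hz)) ?_ (fun w hw => ?_) hg
    · simpa using cauchyKernel_mem_cauchySpan hz
    · simpa using cauchyKernel_mul_mem hz hw
  rw [mul_comm]
  refine cauchySpan_le (hclosed g) ?_ (fun w hw => ?_) hf
  · simpa using hg
  · have := hk hw hg
    rw [mul_comm] at this
    simpa using this

lemma star_mem_cauchySpan {f : BoundedContinuousFunction ℝ ℂ} (hf : f ∈ cauchySpan) :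
    star f ∈ cauchySpan := by
  let W : Submodule ℂ (BoundedContinuousFunction ℝ ℂ) :=
    { carrier := {f | star f ∈ cauchySpan}
      zero_mem' := by simp
      add_mem' := fun ha hb => by
        simp only [Set.mem_ofPred_eq, star_add] at *
        exact cauchySpan.add_mem ha hb
      smul_mem' := fun c f hf => by
        simp only [Set.mem_ofPred_eq, star_smul] at *
        exact cauchySpan.smul_mem _ hf }
  have hW : IsClosed (W : Set (BoundedContinuousFunction ℝ ℂ)) :=
    (Submodule.isClosed_topologicalClosure _).preimage continuous_star
  refine cauchySpan_le hW ?_ (fun z hz => ?_) hf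
  · change star 1 ∈ cauchySpan
    rw [star_one]; exact one_mem_cauchySpan
  · change star (cauchyKernel z hz) ∈ cauchySpan
    have h : star (cauchyKernel z hz) = cauchyKernel (conj z) (by simpa using hz) := by
      ext x
      simp [cauchyKernel_apply]
    rw [h]
    exact cauchyKernel_mem_cauchySpan _

/-- The Stieltjes transform and the total mass determine a finite measure. -/
lemma eq_of_stieltjesTransform_eq {μ τ : Measure ℝ} [IsFiniteMeasure μ] [IsFiniteMeasure τ]
    (h0 : μ.real Set.univ = τ.real Set.univ)
    (h : ∀ z : ℂ, z.im ≠ 0 → stieltjesTransform μ z = stieltjesTransform τ z) : μ = τ := by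
  let A : StarSubalgebra ℂ (BoundedContinuousFunction ℝ ℂ) :=
    { carrier := cauchySpan
      mul_mem' := mul_mem_cauchySpan
      add_mem' := cauchySpan.add_mem
      algebraMap_mem' := fun c => by
        rw [Algebra.algebraMap_eq_smul_one]
        exact cauchySpan.smul_mem _ one_mem_cauchySpan
      star_mem' := star_mem_cauchySpan }
  have hI : Complex.I.im ≠ 0 := by simp
  refine ext_of_forall_mem_subalgebra_integral_eq_of_polish (A := A) (fun x y hxy => ?_)
    fun g hg => ?_
  · refine ⟨cauchyKernel Complex.I hI, ?_, fun h => hxy ?_⟩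
    · simp only [StarSubalgebra.coe_toSubalgebra, StarSubalgebra.coe_map, Set.mem_image,
        SetLike.mem_coe, exists_exists_and_eq_and]
      exact ⟨cauchyKernel Complex.I hI, cauchyKernel_mem_cauchySpan hI, rfl⟩
    · simp only [cauchyKernel_apply, one_div, inv_inj, sub_left_inj] at h
      exact_mod_cast h
  · let W : Submodule ℂ (BoundedContinuousFunction ℝ ℂ) :=
      { carrier := {g | ∫ x, g x ∂μ = ∫ x, g x ∂τ}
        zero_mem' := by simp
        add_mem' := fun {a b} ha hb => by
          simp only [Set.mem_ofPred_eq, BoundedContinuousFunction.coe_add, Pi.add_apply] at *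
          rw [integral_add (a.integrable μ) (b.integrable μ),
            integral_add (a.integrable τ) (b.integrable τ), ha, hb]
        smul_mem' := fun c f hf => by
          simp only [Set.mem_ofPred_eq, BoundedContinuousFunction.coe_smul] at *
          rw [integral_smul, integral_smul, hf] }
    have hcont (ρ : Measure ℝ) [IsFiniteMeasure ρ] :
        Continuous fun g : BoundedContinuousFunction ℝ ℂ => ∫ x, g x ∂ρ := by
      refine (LipschitzWith.of_dist_le_mul (K := ⟨ρ.real Set.univ, measureReal_nonneg⟩)
        fun f g => ?_).continuous
      rw [dist_eq_norm, dist_eq_norm, ← integral_sub (f.integrable ρ) (g.integrable ρ)]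
      exact (f - g).norm_integral_le_mul_norm ρ
    have hW : IsClosed (W : Set (BoundedContinuousFunction ℝ ℂ)) :=
      isClosed_eq (hcont μ) (hcont τ)
    refine cauchySpan_le hW ?_ (fun z hz => h z hz) hg
    change ∫ x, (1 : BoundedContinuousFunction ℝ ℂ) x ∂μ
      = ∫ x, (1 : BoundedContinuousFunction ℝ ℂ) x ∂τ
    simp [h0]

lemma norm_stieltjesTransform_add_le {ρ : Measure ℝ} (hρ : ρ ∈ MStar) {z : ℂ} (hz : z.im ≠ 0)
    {P : ℂ[X]} (hP : P.eval z = 1) {ε : ℝ} (hε : 0 < ε)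
    (hPε : ∫ x : ℝ, ‖P.eval (x : ℂ)‖ ^ 2 ∂ρ < ε * ε) :
    ‖stieltjesTransform ρ z + ∫ x : ℝ, (divDiff z P).eval (x : ℂ) ∂ρ‖
      ≤ ε * ((ρ.real Set.univ + 1) / |z.im|) := by
  have := isFiniteMeasure_of_mem_MStar hρ
  have him := abs_pos.2 hz
  rw [stieltjesTransform, ← integral_add (integrable_cauchyKernel hz) (integrable_evalC hρ _)]
  have hbound : Integrable (fun x : ℝ => (ε + ε⁻¹ * ‖P.eval (x : ℂ)‖ ^ 2) / |z.im|) ρ :=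
    ((integrable_const ε).add ((integrable_norm_sq hρ P).const_mul ε⁻¹)).div_const _
  calc _ ≤ ∫ x : ℝ, (ε + ε⁻¹ * ‖P.eval (x : ℂ)‖ ^ 2) / |z.im| ∂ρ := by
        refine norm_integral_le_of_norm_le hbound (ae_of_all _ fun x => ?_)
        have h1 := eval_eq_divDiff z x P
        have h2 := ofReal_sub_ne_zero hz x
        have h3 : 1 / ((x : ℂ) - z) + (divDiff z P).eval (x : ℂ)
            = P.eval (x : ℂ) / ((x : ℂ) - z) := by
          rw [h1, hP]; field_simp
        rw [h3, norm_div]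
        have h4 : ‖P.eval (x : ℂ)‖ ≤ ε + ε⁻¹ * ‖P.eval (x : ℂ)‖ ^ 2 := by
          have h5 : 0 ≤ ε⁻¹ * (‖P.eval (x : ℂ)‖ - ε) ^ 2 := by positivity
          have h6 : ε⁻¹ * (‖P.eval (x : ℂ)‖ - ε) ^ 2
              = ε⁻¹ * ‖P.eval (x : ℂ)‖ ^ 2 - 2 * ‖P.eval (x : ℂ)‖ + ε := by
            field_simp; ring
          nlinarith [norm_nonneg (P.eval (x : ℂ))]
        exact div_le_div₀ (by positivity) h4 him (abs_im_le_norm_ofReal_sub z x)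
    _ = (ε * ρ.real Set.univ + ε⁻¹ * ∫ x : ℝ, ‖P.eval (x : ℂ)‖ ^ 2 ∂ρ) / |z.im| := by
        rw [integral_div, integral_add (integrable_const ε)
          ((integrable_norm_sq hρ P).const_mul ε⁻¹), integral_const_mul, integral_const,
          smul_eq_mul, mul_comm (ρ.real _)]
    _ ≤ (ε * ρ.real Set.univ + ε⁻¹ * (ε * ε)) / |z.im| := by gcongr
    _ = _ := by field_simp

lemma stieltjesTransform_eq_of_not_evalBounded {μ τ : Measure ℝ} (hμ : μ ∈ MStar)
    (hτ : τ ∈ solutions μ) {z : ℂ} (hz : z.im ≠ 0) (h : ¬ EvalBounded μ z) :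
    stieltjesTransform τ z = stieltjesTransform μ z := by
  set c : ℝ := (τ.real Set.univ + 1) / |z.im| + (μ.real Set.univ + 1) / |z.im| with hc
  have hc0 : 0 < c := by
    have := abs_pos.2 hz
    positivity
  rw [← sub_eq_zero, ← norm_eq_zero]
  refine le_antisymm (le_of_forall_pos_le_add fun ε hε => ?_) (norm_nonneg _)
  have hε' : 0 < ε / c := by positivity
  obtain ⟨P, hP1, hP2⟩ := exists_eval_one_of_not_evalBounded h (mul_pos hε' hε')
  have h1 := norm_stieltjesTransform_add_le hμ hz hP1 hε' hP2
  have h2 := norm_stieltjesTransform_add_le hτ.1 hz hP1 hε'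
    (by rwa [integral_norm_sq_eq hμ hτ])
  rw [integral_evalC_eq hμ hτ] at h2
  calc _ = ‖(stieltjesTransform τ z + ∫ x : ℝ, (divDiff z P).eval (x : ℂ) ∂μ)
        - (stieltjesTransform μ z + ∫ x : ℝ, (divDiff z P).eval (x : ℂ) ∂μ)‖ := by
        congr 1; ring
    _ ≤ _ := norm_sub_le _ _
    _ ≤ ε / c * ((τ.real Set.univ + 1) / |z.im|) + ε / c * ((μ.real Set.univ + 1) / |z.im|) :=
        add_le_add h2 h1
    _ = 0 + ε := by rw [← mul_add, ← hc]; field_simp; ring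

/-- A measure for which no evaluation off the real line is bounded is determinate. -/
theorem mem_MDet_of_not_evalBounded {μ : Measure ℝ} (hμ : μ ∈ MStar)
    (h : ∀ z : ℂ, z.im ≠ 0 → ¬ EvalBounded μ z) : μ ∈ MDet := by
  refine ⟨hμ, fun τ hτ => ?_⟩
  have := isFiniteMeasure_of_mem_MStar hμ
  have := isFiniteMeasure_of_mem_MStar hτ.1
  refine eq_of_stieltjesTransform_eq ?_ fun z hz =>
    stieltjesTransform_eq_of_not_evalBounded hμ hτ hz (h z hz)
  simpa [moment] using hτ.2 0

/-! ### A lacunary discrete measure -/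

/-- The product `∏_{j = 1}^n (2^j - 1)`. -/
noncomputable def qFac (n : ℕ) : ℝ := ∏ j ∈ Finset.range n, (2 ^ (j + 1) - 1)

lemma qFac_succ (n : ℕ) : qFac (n + 1) = qFac n * (2 ^ (n + 1) - 1) := Finset.prod_range_succ _ _

lemma one_le_two_pow_succ_sub_one (n : ℕ) : (1 : ℝ) ≤ 2 ^ (n + 1) - 1 := by
  have : (1 : ℝ) ≤ 2 ^ n := one_le_pow₀ (by norm_num)
  rw [pow_succ]; linarith

lemma qFac_pos (n : ℕ) : 0 < qFac n :=
  Finset.prod_pos fun j _ => by linarith [one_le_two_pow_succ_sub_one j]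

/-- The weights `(-1)ⁿ 2ⁿ / ∏_{j = 1}^n (2^j - 1)`. Up to sign they are the numbers `1 / F'(2ⁿ)`
for the entire function `F(x) = c ∏ (1 - x / 2ⁿ)`, with a suitable constant `c`. -/
noncomputable def annWeight (n : ℕ) : ℝ := (-1) ^ n * 2 ^ n / qFac n

lemma annWeight_succ (n : ℕ) : annWeight (n + 1) * (2 ^ (n + 1) - 1) = -2 * annWeight n := by
  have h1 := (qFac_pos n).ne'
  have h2 : (2 ^ (n + 1) - 1 : ℝ) ≠ 0 := by linarith [one_le_two_pow_succ_sub_one n]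
  rw [annWeight, annWeight, qFac_succ]
  field_simp
  ring

lemma annWeight_ne_zero (n : ℕ) : annWeight n ≠ 0 :=
  div_ne_zero (by simp) (qFac_pos n).ne'

lemma abs_annWeight (n : ℕ) : |annWeight n| = 2 ^ n / qFac n := by
  simp [annWeight, abs_div, abs_mul, abs_of_pos (qFac_pos n)]

lemma abs_annWeight_succ (n : ℕ) :
    |annWeight (n + 1)| = 2 / (2 ^ (n + 1) - 1) * |annWeight n| := by
  have h1 := (qFac_pos n).ne'
  have h2 : (2 ^ (n + 1) - 1 : ℝ) ≠ 0 := by linarith [one_le_two_pow_succ_sub_one n]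
  rw [abs_annWeight, abs_annWeight, qFac_succ]
  field_simp
  ring

lemma abs_annWeight_le_two (n : ℕ) : |annWeight n| ≤ 2 := by
  induction n with
  | zero => simp [annWeight, qFac]
  | succ n ih =>
    rcases Nat.eq_zero_or_pos n with rfl | hn
    · simp [annWeight, qFac]; norm_num
    · refine le_trans ?_ ih
      rw [abs_annWeight_succ]
      refine mul_le_of_le_one_left (abs_nonneg _) ?_
      have h1 := one_le_two_pow_succ_sub_one n
      rw [div_le_one (by linarith)]
      have : (2 : ℝ) ^ 2 ≤ 2 ^ (n + 1) := pow_le_pow_right₀ (by norm_num) (by omega)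
      linarith

lemma summable_annWeight_mul_pow {r : ℝ} (hr : 0 < r) : Summable fun n => annWeight n * r ^ n := by
  refine summable_of_ratio_test_tendsto_lt_one zero_lt_one
    (Eventually.of_forall fun n => mul_ne_zero (annWeight_ne_zero n) (pow_pos hr n).ne') ?_
  have h1 (n : ℕ) : ‖annWeight (n + 1) * r ^ (n + 1)‖ / ‖annWeight n * r ^ n‖
      = 2 * r / (2 ^ (n + 1) - 1) := by
    have h1 := abs_ne_zero.2 (annWeight_ne_zero n)
    have h2 : (2 ^ (n + 1) - 1 : ℝ) ≠ 0 := by linarith [one_le_two_pow_succ_sub_one n]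
    simp only [norm_mul, Real.norm_eq_abs, abs_annWeight_succ, abs_pow, abs_of_pos hr]
    field_simp
    ring
  simp only [h1]
  refine tendsto_const_nhds.div_atTop (tendsto_atTop_add_const_right _ (-1) ?_)
  exact (tendsto_pow_atTop_atTop_of_one_lt (by norm_num : (1 : ℝ) < 2)).comp
    (tendsto_add_atTop_nat 1)

/-- The generating function of the weights satisfies `G(2r) = (1 - 2r) G(r)`. -/
lemma tsum_annWeight_two_mul {r : ℝ} (hr : 0 < r) :
    ∑' n, annWeight n * (2 * r) ^ n = (1 - 2 * r) * ∑' n, annWeight n * r ^ n := by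
  have h1 := summable_annWeight_mul_pow hr
  have h2 := summable_annWeight_mul_pow (mul_pos two_pos hr)
  have h3 : ∑' n, (annWeight n * (2 * r) ^ n - annWeight n * r ^ n)
      = -2 * r * ∑' n, annWeight n * r ^ n := by
    rw [(h2.sub h1).tsum_eq_zero_add, ← tsum_mul_left]
    simp only [pow_zero, sub_self, zero_add]
    refine tsum_congr fun n => ?_
    linear_combination r ^ (n + 1) * annWeight_succ n
  rw [h2.tsum_sub h1] at h3
  linarith

lemma tsum_annWeight_mul_pow (k : ℕ) : ∑' n, annWeight n * ((2 : ℝ) ^ k) ^ n = 0 := by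
  induction k with
  | zero =>
    have := tsum_annWeight_two_mul (r := 1 / 2) (by norm_num)
    simpa using this
  | succ k ih =>
    rw [pow_succ', tsum_annWeight_two_mul (by positivity), ih, mul_zero]

/-- The weights, placed at the points `2ⁿ`, annihilate all polynomials. -/
lemma hasSum_annWeight_mul_eval (P : ℂ[X]) :
    HasSum (fun n => (annWeight n : ℂ) * P.eval ((2 : ℂ) ^ n)) 0 := by
  induction P using Polynomial.induction_on' with
  | add p q hp hq => simpa [mul_add] using hp.add hq
  | monomial k a =>
    have h1 := (summable_annWeight_mul_pow (r := 2 ^ k) (by positivity)).hasSum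
    rw [tsum_annWeight_mul_pow] at h1
    have h2 := (Complex.hasSum_ofReal.2 h1).mul_left a
    simp only [Complex.ofReal_zero, mul_zero] at h2
    refine h2.congr_fun fun n => ?_
    simp only [eval_monomial]
    push_cast
    ring

/-- The mass at `2ⁿ`. The factor `1 / (n + 1)` makes the sum of `annWeight² / mass` diverge, but
slower than any power of `2ⁿ`. -/
noncomputable def lacMass (n : ℕ) : ℝ := annWeight n ^ 2 / (n + 1)

lemma lacMass_pos (n : ℕ) : 0 < lacMass n := by
  have := annWeight_ne_zero n
  unfold lacMass
  positivity

/-- The measure `∑ lacMass n · δ_{2ⁿ}`. -/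
noncomputable def lacMeasure : Measure ℝ :=
  Measure.sum fun n : ℕ => ENNReal.ofReal (lacMass n) • Measure.dirac ((2 : ℝ) ^ n)

lemma integral_lacMeasure (f : ℝ → ℝ) :
    ∫ x, f x ∂lacMeasure = ∑' n, lacMass n * f (2 ^ n) := by
  rw [lacMeasure, integral_sum_dirac fun n => ENNReal.ofReal_ne_top]
  simp [ENNReal.toReal_ofReal (lacMass_pos _).le]

lemma integrable_lacMeasure_iff {f : ℝ → ℝ} :
    Integrable f lacMeasure ↔ Summable fun n => lacMass n * |f (2 ^ n)| := by
  rw [lacMeasure, integrable_sum_dirac_iff fun n => ENNReal.ofReal_ne_top]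
  simp [ENNReal.toReal_ofReal (lacMass_pos _).le]

lemma lacMeasure_mem_MStar : lacMeasure ∈ MStar := by
  constructor
  · have hinj : Function.Injective fun n : ℕ => (2 : ℝ) ^ n :=
      pow_right_injective₀ (by norm_num) (by norm_num)
    refine (Set.infinite_range_of_injective hinj).mono ?_
    rintro _ ⟨n, rfl⟩
    rw [Measure.mem_support_iff_forall]
    intro U hU
    have h1 : (ENNReal.ofReal (lacMass n) • Measure.dirac ((2 : ℝ) ^ n)) U ≤ lacMeasure U :=
      Measure.le_sum (fun n : ℕ => ENNReal.ofReal (lacMass n) • Measure.dirac ((2 : ℝ) ^ n)) n U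
    refine lt_of_lt_of_le ?_ h1
    rw [Measure.smul_apply, Measure.dirac_apply_of_mem (mem_of_mem_nhds hU)]
    simpa using lacMass_pos n
  · intro k
    rw [integrable_lacMeasure_iff]
    have h1 := ((summable_annWeight_mul_pow (r := 2 ^ k) (by positivity)).abs).mul_left 2
    refine Summable.of_nonneg_of_le (fun n => mul_nonneg (lacMass_pos n).le (abs_nonneg _))
      (fun n => ?_) h1
    have h2 : lacMass n ≤ 2 * |annWeight n| := by
      rw [lacMass, ← sq_abs]
      refine (div_le_self (by positivity) (by linarith [Nat.cast_nonneg (α := ℝ) n])).trans ?_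
      rw [sq]
      exact mul_le_mul_of_nonneg_right (abs_annWeight_le_two n) (abs_nonneg _)
    calc lacMass n * |((2 : ℝ) ^ n) ^ k| ≤ 2 * |annWeight n| * |((2 : ℝ) ^ n) ^ k| := by gcongr
      _ = 2 * |annWeight n * ((2 : ℝ) ^ k) ^ n| := by
        rw [abs_mul, ← pow_mul, ← pow_mul, mul_comm n k, mul_assoc]

/-! ### Unbounded evaluations for the lacunary measure -/

/-- The polynomial `∏_{k < N} (X - 2^k)`. -/
noncomputable def lacPoly (N : ℕ) : ℂ[X] := ∏ k ∈ Finset.range N, (X - C ((2 : ℂ) ^ k))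

/-- The product `∏_{k < N} 2^k`. -/
noncomputable def lacScale (N : ℕ) : ℝ := ∏ k ∈ Finset.range N, (2 : ℝ) ^ k

lemma lacScale_pos (N : ℕ) : 0 < lacScale N := Finset.prod_pos fun k _ => by positivity

lemma eval_lacPoly (N : ℕ) (z : ℂ) :
    (lacPoly N).eval z = (-1) ^ N * lacScale N * ∏ k ∈ Finset.range N, (1 + -(z / 2 ^ k)) := by
  have h : ((-1) ^ N : ℂ) = ∏ k ∈ Finset.range N, (-1) := by simp
  rw [lacPoly, eval_prod, lacScale, h, Complex.ofReal_prod, ← Finset.prod_mul_distrib,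
    ← Finset.prod_mul_distrib]
  refine Finset.prod_congr rfl fun k _ => ?_
  have : (2 : ℂ) ^ k ≠ 0 := by simp
  simp only [eval_sub, eval_X, eval_C]
  push_cast
  field_simp
  ring

lemma eval_lacPoly_of_lt {N n : ℕ} (h : n < N) : (lacPoly N).eval ((2 : ℂ) ^ n) = 0 := by
  rw [lacPoly, eval_prod]
  exact Finset.prod_eq_zero (Finset.mem_range.2 h) (by simp)

lemma eval_lacPoly_add (N j : ℕ) :
    (lacPoly N).eval ((2 : ℂ) ^ (j + N)) = ((lacScale N * (qFac (j + N) / qFac j) : ℝ) : ℂ) := by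
  have h1 : qFac (j + N) / qFac j = ∏ k ∈ Finset.range N, ((2 : ℝ) ^ (j + N - k) - 1) := by
    rw [qFac, Finset.prod_range_add, ← qFac, mul_div_cancel_left₀ _ (qFac_pos j).ne',
      ← Finset.prod_range_reflect]
    refine Finset.prod_congr rfl fun k hk => ?_
    have := Finset.mem_range.1 hk
    congr 2
    omega
  rw [h1, lacScale, ← Finset.prod_mul_distrib, lacPoly, eval_prod, Complex.ofReal_prod]
  refine Finset.prod_congr rfl fun k hk => ?_
  have hk := Finset.mem_range.1 hk
  have h2 : (2 : ℂ) ^ (j + N) = 2 ^ k * 2 ^ (j + N - k) := by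
    rw [← pow_add]; congr 1; omega
  simp only [eval_sub, eval_X, eval_C]
  push_cast
  rw [h2]
  ring

lemma summable_inv_qFac_sq : Summable fun n => (qFac n ^ 2)⁻¹ := by
  have h1 := ((summable_annWeight_mul_pow (r := 1) one_pos).abs).mul_left 2
  refine Summable.of_nonneg_of_le (fun n => by positivity) (fun n => ?_) h1
  have h0 := qFac_pos n
  have h2 : (qFac n)⁻¹ ≤ |annWeight n| := by
    rw [abs_annWeight, div_eq_mul_inv]
    exact le_mul_of_one_le_left (by positivity) (one_le_pow₀ (by norm_num))
  rw [one_pow, mul_one, ← inv_pow, sq]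
  exact mul_le_mul (h2.trans (abs_annWeight_le_two n)) h2 (by positivity) (by norm_num)

lemma dampedNormSq_lacPoly_le (N : ℕ) : dampedNormSq lacMeasure (lacPoly N)
    ≤ lacScale N ^ 2 * (∑' n, (qFac n ^ 2)⁻¹) / (N + 1) := by
  have hint := integrable_div_one_add_sq (integrable_norm_sq lacMeasure_mem_MStar (lacPoly N))
  have hsum := integrable_lacMeasure_iff.1 hint
  have habs (n : ℕ) : |‖(lacPoly N).eval (((2 : ℝ) ^ n : ℝ) : ℂ)‖ ^ 2 / (1 + ((2 : ℝ) ^ n) ^ 2)|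
      = ‖(lacPoly N).eval (((2 : ℝ) ^ n : ℝ) : ℂ)‖ ^ 2 / (1 + ((2 : ℝ) ^ n) ^ 2) :=
    abs_of_nonneg (by positivity)
  simp only [habs] at hsum
  rw [dampedNormSq, integral_lacMeasure, ← hsum.sum_add_tsum_nat_add N, Finset.sum_eq_zero,
    zero_add, mul_div_right_comm, ← tsum_mul_left]
  · refine ((summable_nat_add_iff N).2 hsum).tsum_le_tsum (fun j => ?_)
      (summable_inv_qFac_sq.mul_left _)
    have h0 := qFac_pos (j + N)
    have h1 := qFac_pos j
    have h2 := lacScale_pos N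
    rw [Complex.ofReal_pow, Complex.ofReal_ofNat, eval_lacPoly_add, Complex.norm_real,
      Real.norm_eq_abs, sq_abs, lacMass, ← sq_abs (annWeight _), abs_annWeight]
    have h3 : ((2 : ℝ) ^ (j + N)) ^ 2 / (1 + ((2 : ℝ) ^ (j + N)) ^ 2) ≤ 1 := by
      rw [div_le_one (by positivity)]; linarith
    have h4 : (N : ℝ) + 1 ≤ ((j + N : ℕ) : ℝ) + 1 := by
      push_cast; linarith [Nat.cast_nonneg (α := ℝ) j]
    calc _ = (((2 : ℝ) ^ (j + N)) ^ 2 / (1 + ((2 : ℝ) ^ (j + N)) ^ 2)) *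
          (lacScale N ^ 2 / (((j + N : ℕ) : ℝ) + 1) * (qFac j ^ 2)⁻¹) := by
          field_simp
      _ ≤ 1 * (lacScale N ^ 2 / ((N : ℝ) + 1) * (qFac j ^ 2)⁻¹) := by gcongr
      _ = _ := one_mul _
  · intro n hn
    rw [Complex.ofReal_pow, Complex.ofReal_ofNat, eval_lacPoly_of_lt (Finset.mem_range.1 hn)]
    simp

lemma not_evalBounded_damp_one_lacMeasure {z : ℂ} (hz : z.im ≠ 0) :
    ¬ EvalBounded (damp 1 lacMeasure) z := by
  intro h
  obtain ⟨K, hK0, hK⟩ := h.exists_pos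
  set S := ∑' n, (qFac n ^ 2)⁻¹ with hS
  set f : ℕ → ℂ := fun k => -(z / 2 ^ k) with hf
  have hsum : Summable fun k => ‖f k‖ := by
    have := (summable_geometric_of_lt_one (r := 1 / 2) (by norm_num) (by norm_num)).mul_left ‖z‖
    refine this.congr fun k => ?_
    simp [f, div_eq_mul_inv]
  have hne (k : ℕ) : 1 + f k ≠ 0 := by
    intro h0
    have h1 : z = ((2 ^ k : ℝ) : ℂ) := by
      have : (2 : ℂ) ^ k ≠ 0 := by simp
      simp only [f] at h0
      push_cast
      field_simp at h0
      linear_combination -h0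
    exact hz (by rw [h1]; exact Complex.ofReal_im _)
  have hlim : Tendsto (fun N => ∏ k ∈ Finset.range N, (1 + f k)) atTop (𝓝 (∏' k, (1 + f k))) :=
    (multipliable_one_add_of_summable hsum).hasProd.tendsto_prod_nat
  have hL := tprod_one_add_ne_zero_of_summable hne hsum
  have hbound (N : ℕ) : ‖∏ k ∈ Finset.range N, (1 + f k)‖ ^ 2 ≤ K * S / (N + 1) := by
    have h1 := hK (lacPoly N)
    rw [integral_damp_one] at h1
    have h2 := mul_le_mul_of_nonneg_left (dampedNormSq_lacPoly_le N) hK0.le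
    have h3 := h1.trans h2
    have h4 := lacScale_pos N
    rw [eval_lacPoly, norm_mul, norm_mul, norm_pow, norm_neg, norm_one, one_pow, one_mul,
      Complex.norm_real, Real.norm_of_nonneg h4.le, mul_pow] at h3
    have h5 : K * (lacScale N ^ 2 * S / (N + 1)) = lacScale N ^ 2 * (K * S / (N + 1)) := by ring
    rw [h5] at h3
    exact le_of_mul_le_mul_left h3 (by positivity)
  have h0 : Tendsto (fun N : ℕ => K * S / ((N : ℝ) + 1)) atTop (𝓝 0) :=
    tendsto_const_nhds.div_atTop (tendsto_atTop_add_const_right _ 1 tendsto_natCast_atTop_atTop)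
  have h1 := le_of_tendsto_of_tendsto' (hlim.norm.pow 2) h0 hbound
  have h2 : 0 < ‖∏' k, (1 + f k)‖ := norm_pos_iff.2 hL
  nlinarith

/-! ### A bounded evaluation for the damped lacunary measure -/

lemma norm_sq_two_pow_sub_I (n : ℕ) : ‖(2 : ℂ) ^ n - Complex.I‖ ^ 2 = 1 + ((2 : ℝ) ^ n) ^ 2 := by
  have := norm_sq_ofReal_sub_I ((2 : ℝ) ^ n)
  push_cast at this
  exact this

lemma two_pow_sub_I_ne_zero (n : ℕ) : (2 : ℂ) ^ n - Complex.I ≠ 0 := by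
  intro h
  have h1 := norm_sq_two_pow_sub_I n
  rw [h, norm_zero] at h1
  have : (0 : ℝ) < 1 + ((2 : ℝ) ^ n) ^ 2 := by positivity
  linarith

lemma summable_annWeight_div : Summable fun n => (annWeight n : ℂ) / ((2 : ℂ) ^ n - Complex.I) := by
  refine Summable.of_norm_bounded (g := fun n => |annWeight n * 1 ^ n|)
    (summable_annWeight_mul_pow one_pos).abs fun n => ?_
  rw [norm_div, Complex.norm_real, one_pow, mul_one, Real.norm_eq_abs]
  refine div_le_self (abs_nonneg _) ?_
  have h1 := norm_sq_two_pow_sub_I n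
  nlinarith [norm_nonneg ((2 : ℂ) ^ n - Complex.I), sq_nonneg ((2 : ℝ) ^ n)]

/-- The imaginary part of the sum is an alternating series. -/
lemma tsum_annWeight_div_ne_zero : ∑' n, (annWeight n : ℂ) / ((2 : ℂ) ^ n - Complex.I) ≠ 0 := by
  set f : ℕ → ℝ := fun n => |annWeight n| / (1 + ((2 : ℝ) ^ n) ^ 2) with hf
  have him (n : ℕ) : ((annWeight n : ℂ) / ((2 : ℂ) ^ n - Complex.I)).im = (-1) ^ n * f n := by
    have h2 : ((2 : ℂ) ^ n - Complex.I).im = -1 := by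
      have : (2 : ℂ) ^ n = (((2 : ℝ) ^ n : ℝ) : ℂ) := by push_cast; rfl
      rw [this, Complex.sub_im, Complex.ofReal_im, Complex.I_im]; ring
    have h3 : annWeight n = (-1) ^ n * |annWeight n| := by
      rw [abs_annWeight, annWeight]; ring
    rw [Complex.div_im, Complex.normSq_eq_norm_sq, norm_sq_two_pow_sub_I, h2, Complex.ofReal_im,
      Complex.ofReal_re]
    simp only [hf]
    conv_lhs => rw [h3]
    ring
  have hanti : Antitone f := by
    refine antitone_nat_of_succ_le fun n => ?_
    have h1 := one_le_two_pow_succ_sub_one n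
    have h2 : (1 : ℝ) ≤ 2 ^ n := one_le_pow₀ (by norm_num)
    simp only [hf]
    rw [abs_annWeight_succ, pow_succ] at *
    set t : ℝ := 2 ^ n
    have h3 : 2 / (t * 2 - 1) ≤ (1 + (t * 2) ^ 2) / (1 + t ^ 2) := by
      rw [div_le_div_iff₀ (by linarith) (by positivity)]
      nlinarith [mul_nonneg (sub_nonneg.2 h2) (sub_nonneg.2 h2),
        mul_nonneg (mul_nonneg (sub_nonneg.2 h2) (sub_nonneg.2 h2)) (sub_nonneg.2 h2)]
    calc 2 / (t * 2 - 1) * |annWeight n| / (1 + (t * 2) ^ 2)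
        ≤ (1 + (t * 2) ^ 2) / (1 + t ^ 2) * |annWeight n| / (1 + (t * 2) ^ 2) := by gcongr
      _ = |annWeight n| / (1 + t ^ 2) := by field_simp
  have hs := (Complex.hasSum_im summable_annWeight_div.hasSum).tendsto_sum_nat
  simp only [him] at hs
  have hle := hanti.alternating_series_le_tendsto hs 1
  intro h
  rw [h] at hle
  simp [Finset.sum_range_succ, hf, abs_annWeight, qFac] at hle
  norm_num at hle

/-- The residue formula `P(i) ∑ aₙ / (2ⁿ - i) = ∑ aₙ P(2ⁿ) / (2ⁿ - i)`, with `aₙ` the annihilating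
weights. -/
lemma hasSum_annWeight_mul_eval_div (P : ℂ[X]) :
    HasSum (fun n => (annWeight n : ℂ) * P.eval ((2 : ℂ) ^ n) / ((2 : ℂ) ^ n - Complex.I))
      (P.eval Complex.I * ∑' n, (annWeight n : ℂ) / ((2 : ℂ) ^ n - Complex.I)) := by
  have h1 := summable_annWeight_div.hasSum.mul_left (P.eval Complex.I)
  have h2 := hasSum_annWeight_mul_eval (divDiff Complex.I P)
  have h3 := h1.add h2
  rw [add_zero] at h3
  refine h3.congr_fun fun n => ?_
  have h4 := two_pow_sub_I_ne_zero n
  rw [eval_eq_divDiff Complex.I ((2 : ℂ) ^ n) P]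
  field_simp

lemma evalBounded_damp_lacMeasure {β : ℝ} (hβ0 : 0 ≤ β) (hβ : β < 1) :
    EvalBounded (damp β lacMeasure) Complex.I := by
  set κ := ∑' n, (annWeight n : ℂ) / ((2 : ℂ) ^ n - Complex.I) with hκ
  have hκ0 : 0 < ‖κ‖ := norm_pos_iff.2 tsum_annWeight_div_ne_zero
  set b : ℕ → ℝ := fun n => (n + 1) * (1 + ((2 : ℝ) ^ n) ^ 2) ^ (β - 1) with hb
  have hb0 (n : ℕ) : 0 ≤ b n := by positivity
  have hbs : Summable b := by
    set r : ℝ := 4 ^ (β - 1) with hr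
    have hr1 : ‖r‖ < 1 := by
      rw [Real.norm_of_nonneg (by positivity)]
      exact Real.rpow_lt_one_of_one_lt_of_neg (by norm_num) (by linarith)
    have hs : Summable fun n : ℕ => ((n : ℝ) + 1) * r ^ n := by
      have h1 := (summable_pow_mul_geometric_of_norm_lt_one 1 hr1).add
        (summable_geometric_of_norm_lt_one hr1)
      exact h1.congr fun n => by ring
    refine Summable.of_nonneg_of_le hb0 (fun n => ?_) hs
    simp only [hb]
    gcongr
    have h2 : r ^ n = ((4 : ℝ) ^ n) ^ (β - 1) := by
      rw [hr, ← Real.rpow_natCast, ← Real.rpow_natCast, ← Real.rpow_mul (by norm_num),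
        ← Real.rpow_mul (by norm_num), mul_comm]
    rw [h2, ← pow_mul, mul_comm n 2, pow_mul]
    norm_num only
    exact Real.rpow_le_rpow_of_nonpos (by positivity) (by linarith) (by linarith)
  refine ⟨(∑' n, b n) / ‖κ‖ ^ 2, fun P => ?_⟩
  set a : ℕ → ℝ := fun n =>
    lacMass n * ((1 + ((2 : ℝ) ^ n) ^ 2) ^ (-β) * ‖P.eval ((2 : ℂ) ^ n)‖ ^ 2) with ha
  have ha0 (n : ℕ) : 0 ≤ a n := by
    have := lacMass_pos n
    positivity
  have hint : ∫ x : ℝ, ‖P.eval (x : ℂ)‖ ^ 2 ∂(damp β lacMeasure) = ∑' n, a n := by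
    rw [integral_damp, integral_lacMeasure]
    push_cast
    rfl
  have has : Summable a := by
    have h1 : Integrable (fun x : ℝ => (1 + x ^ 2) ^ (-β) * ‖P.eval (x : ℂ)‖ ^ 2) lacMeasure := by
      refine (integrable_norm_sq lacMeasure_mem_MStar P).mono
        ((measurable_dampWeight β).aestronglyMeasurable.mul
          ((continuous_evalC P).norm.pow 2).aestronglyMeasurable) (ae_of_all _ fun x => ?_)
      rw [norm_mul, Real.norm_of_nonneg (dampWeight_pos β x).le]
      refine mul_le_of_le_one_left (norm_nonneg _) ?_
      exact Real.rpow_le_one_of_one_le_of_nonpos (by nlinarith [sq_nonneg x]) (by linarith)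
    refine (integrable_lacMeasure_iff.1 h1).congr fun n => ?_
    rw [abs_of_nonneg (mul_nonneg (dampWeight_pos β _).le (by positivity))]
    simp only [ha]
    push_cast
    rfl
  have hterm (n : ℕ) : ‖(annWeight n : ℂ) * P.eval ((2 : ℂ) ^ n) / ((2 : ℂ) ^ n - Complex.I)‖ ^ 2
      = a n * b n := by
    have h0 : (0 : ℝ) < 1 + ((2 : ℝ) ^ n) ^ 2 := by positivity
    have h1 : (1 + ((2 : ℝ) ^ n) ^ 2) ^ (-β) * (1 + ((2 : ℝ) ^ n) ^ 2) ^ (β - 1)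
        = (1 + ((2 : ℝ) ^ n) ^ 2)⁻¹ := by
      rw [← Real.rpow_add h0, ← Real.rpow_neg_one]; congr 1; ring
    rw [norm_div, norm_mul, div_pow, mul_pow, norm_sq_two_pow_sub_I, Complex.norm_real,
      Real.norm_eq_abs, sq_abs]
    simp only [ha, hb, lacMass]
    have h2 : (n : ℝ) + 1 ≠ 0 := by positivity
    calc _ = annWeight n ^ 2 * ‖P.eval ((2 : ℂ) ^ n)‖ ^ 2 * (1 + ((2 : ℝ) ^ n) ^ 2)⁻¹ :=
          div_eq_mul_inv _ _
      _ = _ := by rw [← h1]; field_simp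
  have hfin (s : Finset ℕ) :
      ‖∑ n ∈ s, (annWeight n : ℂ) * P.eval ((2 : ℂ) ^ n) / ((2 : ℂ) ^ n - Complex.I)‖ ^ 2
        ≤ (∑' n, a n) * ∑' n, b n := by
    calc _ ≤ (∑ n ∈ s, √(a n) * √(b n)) ^ 2 := by
          gcongr
          refine norm_sum_le_of_le _ fun n _ => ?_
          rw [← Real.sqrt_mul (ha0 n), ← hterm, Real.sqrt_sq (norm_nonneg _)]
      _ ≤ (∑ n ∈ s, √(a n) ^ 2) * ∑ n ∈ s, √(b n) ^ 2 := Finset.sum_mul_sq_le_sq_mul_sq _ _ _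
      _ = (∑ n ∈ s, a n) * ∑ n ∈ s, b n := by
          simp only [Real.sq_sqrt (ha0 _), Real.sq_sqrt (hb0 _)]
      _ ≤ _ := mul_le_mul (has.sum_le_tsum s fun n _ => ha0 n)
          (hbs.sum_le_tsum s fun n _ => hb0 n) (Finset.sum_nonneg fun n _ => hb0 n)
          (tsum_nonneg ha0)
  have hlim := le_of_tendsto' ((hasSum_annWeight_mul_eval_div P).norm.pow 2) hfin
  rw [norm_mul, mul_pow] at hlim
  rw [hint, div_mul_eq_mul_div, le_div_iff₀ (by positivity)]
  linarith

/-! ### Existence of the orthonormal polynomials -/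

/-- Integration of real polynomials, as a linear functional. -/
noncomputable def polyIntegral {μ : Measure ℝ} (hμ : μ ∈ MStar) : ℝ[X] →ₗ[ℝ] ℝ where
  toFun P := ∫ x, P.eval x ∂μ
  map_add' P Q := by
    simp only [eval_add]
    exact integral_add (integrable_eval hμ P) (integrable_eval hμ Q)
  map_smul' a P := by
    simp only [eval_smul, smul_eq_mul, RingHom.id_apply]
    exact integral_const_mul _ _

/-- The orthonormal polynomials, by the Gram–Schmidt process applied to the powers of `X`. -/
noncomputable def orthPoly {μ : Measure ℝ} (hμ : μ ∈ MStar) : ℕ → ℝ[X]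
  | n =>
    let P := X ^ n - ∑ k : Fin n, polyIntegral hμ (X ^ n * orthPoly hμ k) • orthPoly hμ k
    (√(polyIntegral hμ (P * P)))⁻¹ • P
termination_by n => n
decreasing_by exact k.2

lemma orthPoly_spec {μ : Measure ℝ} (hμ : μ ∈ MStar) (n : ℕ) :
    ((orthPoly hμ n).natDegree = n ∧ 0 < (orthPoly hμ n).leadingCoeff) ∧
      polyIntegral hμ (orthPoly hμ n * orthPoly hμ n) = 1 ∧
      ∀ k < n, polyIntegral hμ (orthPoly hμ n * orthPoly hμ k) = 0 := by
  induction n using Nat.strong_induction_on with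
  | _ n ih =>
  set T : ℝ[X] := ∑ k : Fin n, polyIntegral hμ (X ^ n * orthPoly hμ k) • orthPoly hμ k with hT
  set P : ℝ[X] := X ^ n - T with hP
  have hdef : orthPoly hμ n = (√(polyIntegral hμ (P * P)))⁻¹ • P := by
    rw [orthPoly]
  have hTdeg : T.degree < (X ^ n : ℝ[X]).degree := by
    rw [degree_X_pow, ← mem_degreeLT]
    refine Submodule.sum_mem _ fun k _ => Submodule.smul_mem _ _ ?_
    rw [mem_degreeLT]
    refine degree_le_natDegree.trans_lt ?_
    rw [(ih k k.2).1.1]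
    exact_mod_cast k.2
  have hPdeg : P.natDegree = n := by
    rw [natDegree_eq_of_degree_eq (degree_sub_eq_left_of_degree_lt hTdeg), natDegree_X_pow]
  have hPlc : P.leadingCoeff = 1 := by
    rw [hP, leadingCoeff_sub_of_degree_lt hTdeg, leadingCoeff_X_pow]
  have hP0 : P ≠ 0 := by
    rintro h; rw [h] at hPlc; simp at hPlc
  have hpos : 0 < polyIntegral hμ (P * P) := by
    have := integral_sq_pos hμ hP0
    simpa [polyIntegral, sq] using this
  have hc : (√(polyIntegral hμ (P * P)))⁻¹ ≠ 0 := inv_ne_zero (Real.sqrt_pos.2 hpos).ne'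
  have horth (j : ℕ) (hj : j < n) : polyIntegral hμ (P * orthPoly hμ j) = 0 := by
    have h1 (k : Fin n) : polyIntegral hμ (orthPoly hμ k * orthPoly hμ j)
        = if k = ⟨j, hj⟩ then 1 else 0 := by
      split_ifs with h
      · subst h; exact (ih j hj).2.1
      · have hne : (k : ℕ) ≠ j := fun h' => h (Fin.ext h')
        rcases lt_or_gt_of_ne hne with h2 | h2
        · rw [mul_comm]; exact (ih j hj).2.2 k h2
        · exact (ih k k.2).2.2 j h2
    rw [hP, sub_mul, map_sub, hT, Finset.sum_mul, map_sum]
    simp only [smul_mul_assoc, map_smul, h1, smul_eq_mul, mul_ite, mul_one, mul_zero,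
      Finset.sum_ite_eq', Finset.mem_univ, if_true, sub_self]
  refine ⟨⟨?_, ?_⟩, ?_, fun k hk => ?_⟩
  · rw [hdef, natDegree_smul _ hc, hPdeg]
  · rw [hdef, smul_eq_C_mul, leadingCoeff_mul, leadingCoeff_C, hPlc, mul_one]
    exact inv_pos.2 (Real.sqrt_pos.2 hpos)
  · rw [hdef, smul_mul_smul_comm, map_smul, smul_eq_mul, ← mul_inv,
      Real.mul_self_sqrt hpos.le, inv_mul_cancel₀ hpos.ne']
  · rw [hdef, smul_mul_assoc, map_smul, horth k hk, smul_zero]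

lemma isOrthonormalPolynomials_orthPoly {μ : Measure ℝ} (hμ : μ ∈ MStar) :
    IsOrthonormalPolynomials μ (orthPoly hμ) := by
  refine ⟨fun n => (orthPoly_spec hμ n).1, fun n m => ?_⟩
  have h : ∫ x, (orthPoly hμ n).eval x * (orthPoly hμ m).eval x ∂μ
      = polyIntegral hμ (orthPoly hμ n * orthPoly hμ m) := by
    simp [polyIntegral]
  rw [h]
  split_ifs with hnm
  · subst hnm; exact (orthPoly_spec hμ n).2.1
  · rcases lt_or_gt_of_ne hnm with h2 | h2
    · rw [mul_comm]; exact (orthPoly_spec hμ m).2.2 n h2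
    · exact (orthPoly_spec hμ n).2.2 m h2

/-! ### Polynomials of the second kind -/

lemma divDiff_unique {w : ℂ} {P D : ℂ[X]} {c : ℂ} (h : P = (X - C w) * D + C c) :
    divDiff w P = D := by
  have hc : P.eval w = c := by rw [h]; simp
  have h1 := mul_divDiff w P
  rw [hc] at h1
  conv_rhs at h1 => rw [h]
  exact mul_left_cancel₀ (X_sub_C_ne_zero w) (add_right_cancel h1)

/-- The divided difference at `w`, as a linear map. -/
noncomputable def divDiffLinear (w : ℂ) : ℂ[X] →ₗ[ℂ] ℂ[X] where
  toFun := divDiff w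
  map_add' P Q := by
    refine divDiff_unique (c := P.eval w + Q.eval w) ?_
    conv_lhs => rw [← mul_divDiff w P, ← mul_divDiff w Q]
    simp only [C_add]
    ring
  map_smul' a P := by
    refine divDiff_unique (c := a * P.eval w) ?_
    conv_lhs => rw [← mul_divDiff w P]
    simp only [smul_eq_C_mul, C_mul, RingHom.id_apply]
    ring

lemma divDiff_sub_divDiff (z w : ℂ) (P : ℂ[X]) :
    divDiff z P - divDiff w P = C (z - w) * divDiff z (divDiff w P) := by
  rw [sub_eq_iff_eq_add]
  refine divDiff_unique (c := P.eval w + (z - w) * (divDiff w P).eval z) ?_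
  have h1 := mul_divDiff w P
  have h2 := mul_divDiff z (divDiff w P)
  simp only [C_add, C_mul, C_sub] at *
  linear_combination -h1 + (C w - C z) * h2

lemma degree_divDiff_lt (w : ℂ) {P : ℂ[X]} (hP : P ≠ 0) : (divDiff w P).degree < P.degree :=
  degree_divByMonic_lt _ (X - C w) hP (by rw [degree_X_sub_C]; exact zero_lt_one)

lemma dslope_eval (P : ℂ[X]) (x z : ℂ) :
    dslope (fun w => P.eval w) x z = (divDiff z P).eval x := by
  by_cases h : z = x
  · subst h
    rw [dslope_same, Polynomial.deriv]
    conv_lhs => rw [← mul_divDiff z P]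
    simp
  · rw [dslope_of_ne _ h, slope_def_field, eval_eq_divDiff z x P]
    have := sub_ne_zero.2 h
    field_simp
    ring

/-- Integration of complex polynomials, as a linear functional. -/
noncomputable def polyIntegralC {μ : Measure ℝ} (hμ : μ ∈ MStar) : ℂ[X] →ₗ[ℂ] ℂ where
  toFun P := ∫ x : ℝ, P.eval (x : ℂ) ∂μ
  map_add' P Q := by
    simp only [eval_add]
    exact integral_add (integrable_evalC hμ P) (integrable_evalC hμ Q)
  map_smul' a P := by
    simp only [eval_smul, smul_eq_mul, RingHom.id_apply]
    exact integral_const_mul _ _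

lemma polyIntegralC_apply {μ : Measure ℝ} (hμ : μ ∈ MStar) (P : ℂ[X]) :
    polyIntegralC hμ P = ∫ x : ℝ, P.eval (x : ℂ) ∂μ := rfl

/-- The polynomial `p n` with complex coefficients. -/
noncomputable def complexify (p : ℕ → ℝ[X]) (n : ℕ) : ℂ[X] := (p n).map (algebraMap ℝ ℂ)

lemma evalP_eq (p : ℕ → ℝ[X]) (n : ℕ) (z : ℂ) : evalP p n z = (complexify p n).eval z := by
  rw [evalP, complexify, eval_map_algebraMap]

lemma eval_complexify_ofReal (p : ℕ → ℝ[X]) (n : ℕ) (x : ℝ) :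
    (complexify p n).eval (x : ℂ) = (((p n).eval x : ℝ) : ℂ) := by
  rw [complexify, eval_map]
  exact Polynomial.eval₂_at_apply (algebraMap ℝ ℂ) x

lemma evalQ_eq {μ : Measure ℝ} (hμ : μ ∈ MStar) (p : ℕ → ℝ[X]) (n : ℕ) (z : ℂ) :
    evalQ μ p n z = polyIntegralC hμ (divDiff z (complexify p n)) := by
  have h : evalP p n = fun w => (complexify p n).eval w := funext (evalP_eq p n)
  rw [evalQ, polyIntegralC_apply, h]
  simp only [dslope_eval]

lemma degree_complexify {μ : Measure ℝ} {p : ℕ → ℝ[X]} (hp : IsOrthonormalPolynomials μ p)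
    (n : ℕ) : (complexify p n).degree = n := by
  have h0 : p n ≠ 0 := by
    intro h
    have := (hp.1 n).2
    simp [h] at this
  rw [complexify, degree_map, degree_eq_natDegree h0, (hp.1 n).1]

lemma complexify_ne_zero {μ : Measure ℝ} {p : ℕ → ℝ[X]} (hp : IsOrthonormalPolynomials μ p)
    (n : ℕ) : complexify p n ≠ 0 := by
  intro h
  have := degree_complexify hp n
  simp [h] at this

lemma polyIntegralC_mul {μ : Measure ℝ} (hμ : μ ∈ MStar) {p : ℕ → ℝ[X]} (hp : IsOrthonormalPolynomials μ p)
    (n m : ℕ) :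
    polyIntegralC hμ (complexify p n * complexify p m) = if n = m then 1 else 0 := by
  have h := hp.2 n m
  simp only [polyIntegralC_apply, eval_mul, eval_complexify_ofReal, ← Complex.ofReal_mul,
    integral_complex_ofReal, h]
  split_ifs <;> simp

/-- The polynomials of degree less than `n` are spanned by the first `n` orthonormal ones. -/
lemma exists_coeff_of_degree_lt {μ : Measure ℝ} {p : ℕ → ℝ[X]} (hp : IsOrthonormalPolynomials μ p)
    (n : ℕ) {S : ℂ[X]} (hS : S.degree < n) :
    ∃ c : ℕ → ℂ, S = ∑ k ∈ Finset.range n, c k • complexify p k := by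
  induction n generalizing S with
  | zero =>
    refine ⟨0, ?_⟩
    have : S = 0 := degree_eq_bot.1 (Nat.WithBot.lt_zero_iff.1 (by exact_mod_cast hS))
    simp [this]
  | succ n ih =>
    set a : ℂ := S.coeff n / (complexify p n).leadingCoeff with ha
    have hlc : (complexify p n).leadingCoeff ≠ 0 := leadingCoeff_ne_zero.2 (complexify_ne_zero hp n)
    have hnd : (complexify p n).natDegree = n :=
      natDegree_eq_of_degree_eq_some (degree_complexify hp n)
    have hdeg : (S - a • complexify p n).degree < n := by
      rw [degree_lt_iff_coeff_zero]
      intro m hm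
      rcases Nat.eq_or_lt_of_le hm with rfl | hm
      · have : (complexify p n).coeff n = (complexify p n).leadingCoeff := by
          rw [leadingCoeff, hnd]
        rw [coeff_sub, coeff_smul, this, smul_eq_mul, ha, div_mul_cancel₀ _ hlc, sub_self]
      · rw [coeff_sub, coeff_smul, (degree_lt_iff_coeff_zero S (n + 1)).1 hS m (by omega),
          coeff_eq_zero_of_natDegree_lt (by omega : (complexify p n).natDegree < m)]
        simp
    obtain ⟨c, hc⟩ := ih hdeg
    refine ⟨fun k => if k = n then a else c k, ?_⟩
    simp only [Finset.sum_range_succ, if_true]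
    rw [← sub_eq_iff_eq_add, hc]
    refine Finset.sum_congr rfl fun k hk => ?_
    rw [if_neg (Finset.mem_range.1 hk).ne]

lemma polyIntegralC_mul_eq_zero {μ : Measure ℝ} (hμ : μ ∈ MStar) {p : ℕ → ℝ[X]} (hp : IsOrthonormalPolynomials μ p)
    {n : ℕ} {S : ℂ[X]} (hS : S.degree < n) :
    polyIntegralC hμ (complexify p n * S) = 0 := by
  obtain ⟨c, rfl⟩ := exists_coeff_of_degree_lt hp n hS
  rw [Finset.mul_sum, map_sum]
  refine Finset.sum_eq_zero fun k hk => ?_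
  rw [mul_smul_comm, map_smul, polyIntegralC_mul hμ hp, if_neg (Finset.mem_range.1 hk).ne',
    smul_zero]

lemma eq_sum_of_degree_lt {μ : Measure ℝ} (hμ : μ ∈ MStar) {p : ℕ → ℝ[X]} (hp : IsOrthonormalPolynomials μ p)
    {n : ℕ} {S : ℂ[X]} (hS : S.degree < n) :
    S = ∑ k ∈ Finset.range n, polyIntegralC hμ (S * complexify p k) • complexify p k := by
  obtain ⟨c, hc⟩ := exists_coeff_of_degree_lt hp n hS
  have h (j : ℕ) (hj : j ∈ Finset.range n) : polyIntegralC hμ (S * complexify p j) = c j := by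
    rw [hc, Finset.sum_mul, map_sum]
    simp only [smul_mul_assoc, map_smul, polyIntegralC_mul hμ hp, smul_eq_mul, mul_ite, mul_one,
      mul_zero, Finset.sum_ite_eq', hj, if_true]
  rw [Finset.sum_congr rfl fun k hk => by rw [h k hk]]
  exact hc

/-- The expansion of the divided difference of `p n` in orthonormal polynomials. -/
lemma divDiff_complexify {μ : Measure ℝ} (hμ : μ ∈ MStar) {p : ℕ → ℝ[X]} (hp : IsOrthonormalPolynomials μ p)
    (n : ℕ) (w : ℂ) :
    divDiff w (complexify p n) = ∑ k ∈ Finset.range n,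
      (evalP p k w * evalQ μ p n w - evalP p n w * evalQ μ p k w) • complexify p k := by
  have hdeg := degree_divDiff_lt w (complexify_ne_zero hp n)
  rw [degree_complexify hp] at hdeg
  conv_lhs => rw [eq_sum_of_degree_lt hμ hp hdeg]
  refine Finset.sum_congr rfl fun k hk => ?_
  congr 1
  have hk := Finset.mem_range.1 hk
  set Dn := divDiff w (complexify p n) with hDn
  set Dk := divDiff w (complexify p k) with hDk
  have hDk' : Dk.degree < n :=
    (degree_divDiff_lt w (complexify_ne_zero hp k)).trans (by
      rw [degree_complexify hp]; exact_mod_cast hk)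
  have h1 := mul_divDiff w (complexify p n)
  have h2 := mul_divDiff w (complexify p k)
  have h3 : Dn * complexify p k = (complexify p k).eval w • Dn + complexify p n * Dk
      - (complexify p n).eval w • Dk := by
    simp only [smul_eq_C_mul]
    rw [← hDn] at h1
    rw [← hDk] at h2
    linear_combination (-Dn) * h2 + Dk * h1
  rw [h3, map_sub, map_add, map_smul, map_smul, polyIntegralC_mul_eq_zero hμ hp hDk',
    evalQ_eq hμ, evalQ_eq hμ, evalP_eq, evalP_eq, smul_eq_mul, smul_eq_mul, add_zero]

lemma evalP_sub_evalP {μ : Measure ℝ} (hμ : μ ∈ MStar) {p : ℕ → ℝ[X]} (hp : IsOrthonormalPolynomials μ p)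
    (n : ℕ) (z w : ℂ) :
    evalP p n z - evalP p n w = (z - w) * ∑ k ∈ Finset.range n,
      (evalP p k w * evalQ μ p n w - evalP p n w * evalQ μ p k w) * evalP p k z := by
  have h := eval_eq_divDiff w z (complexify p n)
  rw [divDiff_complexify hμ hp, eval_finsetSum] at h
  simp only [eval_smul, smul_eq_mul] at h
  simp only [evalP_eq] at h ⊢
  rw [h, add_sub_cancel_left]

lemma evalQ_sub_evalQ {μ : Measure ℝ} (hμ : μ ∈ MStar) {p : ℕ → ℝ[X]} (hp : IsOrthonormalPolynomials μ p)
    (n : ℕ) (z w : ℂ) :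
    evalQ μ p n z - evalQ μ p n w = (z - w) * ∑ k ∈ Finset.range n,
      (evalP p k w * evalQ μ p n w - evalP p n w * evalQ μ p k w) * evalQ μ p k z := by
  have h1 : divDiff z (divDiff w (complexify p n)) = ∑ k ∈ Finset.range n,
      (evalP p k w * evalQ μ p n w - evalP p n w * evalQ μ p k w) •
        divDiff z (complexify p k) := by
    rw [divDiff_complexify hμ hp]
    change divDiffLinear z _ = _
    rw [map_sum]
    simp only [map_smul]
    rfl
  have h2 := congrArg (polyIntegralC hμ) (divDiff_sub_divDiff z w (complexify p n))
  rw [h1, map_sub, ← smul_eq_C_mul, map_smul, map_sum] at h2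
  simp only [map_smul, ← evalQ_eq hμ, smul_eq_mul] at h2
  exact h2

/-! ### Convergence of the Nevanlinna series -/

/-- A Volterra inequality with square summable kernel `g n * g k`, `k < n`, has square summable
solutions. -/
lemma summable_sq_of_volterra {u g : ℕ → ℝ} {r : ℝ} (hr : 0 ≤ r) (hu : ∀ n, 0 ≤ u n)
    (hg : ∀ n, 0 ≤ g n) (hs : Summable fun n => g n ^ 2)
    (h : ∀ n, u n ≤ g n * (1 + r * ∑ k ∈ Finset.range n, g k * u k)) :
    Summable fun n => u n ^ 2 := by
  set V : ℕ → ℝ := fun n => 1 + r * ∑ k ∈ Finset.range n, g k * u k with hV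
  have hV0 (n : ℕ) : 0 ≤ V n := by
    have : 0 ≤ ∑ k ∈ Finset.range n, g k * u k :=
      Finset.sum_nonneg fun k _ => mul_nonneg (hg k) (hu k)
    positivity
  have hVle (n : ℕ) : V n ≤ Real.exp (r * ∑ k ∈ Finset.range n, g k ^ 2) := by
    induction n with
    | zero => simp [hV]
    | succ n ih =>
      have h1 : V (n + 1) = V n + r * (g n * u n) := by
        simp only [hV, Finset.sum_range_succ]; ring
      calc V (n + 1) ≤ V n + r * (g n * (g n * V n)) := by
            rw [h1]
            have := mul_le_mul_of_nonneg_left (h n) (hg n)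
            gcongr
        _ = V n * (r * g n ^ 2 + 1) := by ring
        _ ≤ Real.exp (r * ∑ k ∈ Finset.range n, g k ^ 2) * Real.exp (r * g n ^ 2) := by
            gcongr
            exact Real.add_one_le_exp _
        _ = _ := by rw [← Real.exp_add, Finset.sum_range_succ, mul_add]
  set K := Real.exp (r * ∑' k, g k ^ 2) with hK
  have hVK (n : ℕ) : V n ≤ K := (hVle n).trans (Real.exp_le_exp.2 (by
    gcongr
    exact hs.sum_le_tsum _ fun k _ => sq_nonneg _))
  refine Summable.of_nonneg_of_le (fun n => sq_nonneg _) (fun n => ?_) (hs.mul_right (K ^ 2))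
  rw [← mul_pow]
  have h1 : u n ≤ g n * K := (h n).trans (mul_le_mul_of_nonneg_left (hVK n) (hg n))
  exact pow_le_pow_left₀ (hu n) h1 2

lemma summable_sq_norm_add {f g : ℕ → ℂ} (hf : Summable fun n => ‖f n‖ ^ 2)
    (hg : Summable fun n => ‖g n‖ ^ 2) : Summable fun n => (‖f n‖ + ‖g n‖) ^ 2 :=
  Summable.of_nonneg_of_le (fun n => sq_nonneg _)
    (fun n => by nlinarith [sq_nonneg (‖f n‖ - ‖g n‖)]) ((hf.mul_left 2).add (hg.mul_left 2))

lemma summable_mul_of_summable_sq {f g : ℕ → ℂ} (hf : Summable fun n => ‖f n‖ ^ 2)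
    (hg : Summable fun n => ‖g n‖ ^ 2) : Summable fun n => f n * g n := by
  refine Summable.of_norm_bounded (hf.add hg) fun n => ?_
  rw [norm_mul]
  nlinarith [sq_nonneg (‖f n‖ - ‖g n‖), sq_nonneg (‖f n‖), sq_nonneg (‖g n‖)]

/-- The recursion by which `p n z` and `q n z` arise from their values at `w` is of Volterra type
with the kernel `p k w * q n w - p n w * q k w`. -/
lemma summable_sq_of_recursion {a b F : ℕ → ℂ} {F₀ : ℕ → ℂ} {c : ℂ}
    (ha : Summable fun n => ‖a n‖ ^ 2) (hb : Summable fun n => ‖b n‖ ^ 2)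
    (hF₀ : ∀ n, ‖F₀ n‖ ≤ ‖a n‖ + ‖b n‖)
    (h : ∀ n, F n - F₀ n = c * ∑ k ∈ Finset.range n, (a k * b n - a n * b k) * F k) :
    Summable fun n => ‖F n‖ ^ 2 := by
  refine summable_sq_of_volterra (r := ‖c‖) (g := fun n => ‖a n‖ + ‖b n‖) (norm_nonneg _)
    (fun n => norm_nonneg _) (fun n => by positivity) (summable_sq_norm_add ha hb) fun n => ?_
  have h1 : F n = F₀ n + c * ∑ k ∈ Finset.range n, (a k * b n - a n * b k) * F k := by
    rw [← h]; ring
  calc ‖F n‖ ≤ ‖F₀ n‖ + ‖c‖ * ‖∑ k ∈ Finset.range n, (a k * b n - a n * b k) * F k‖ := by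
        conv_lhs => rw [h1]
        rw [← norm_mul]
        exact norm_add_le _ _
    _ ≤ (‖a n‖ + ‖b n‖) + ‖c‖ * ∑ k ∈ Finset.range n,
          (‖a n‖ + ‖b n‖) * ((‖a k‖ + ‖b k‖) * ‖F k‖) := by
        gcongr
        · exact hF₀ n
        · refine norm_sum_le_of_le _ fun k _ => ?_
          rw [norm_mul, ← mul_assoc]
          gcongr
          refine (norm_sub_le _ _).trans ?_
          rw [norm_mul, norm_mul]
          nlinarith [mul_nonneg (norm_nonneg (a n)) (norm_nonneg (a k)),
            mul_nonneg (norm_nonneg (b n)) (norm_nonneg (b k))]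
    _ = _ := by rw [← Finset.mul_sum]; ring

/-- The determinant identity behind the formulas of Christoffel–Darboux type. -/
lemma determinant_partial_sums {a b R R' : ℕ → ℂ} {z w α γ α' γ' : ℂ}
    (h : ∀ n, R n = b n * (γ + z * ∑ k ∈ Finset.range n, a k * R k)
      - a n * (α + z * ∑ k ∈ Finset.range n, b k * R k))
    (h' : ∀ n, R' n = b n * (γ' + w * ∑ k ∈ Finset.range n, a k * R' k)
      - a n * (α' + w * ∑ k ∈ Finset.range n, b k * R' k)) (n : ℕ) :
    (α + z * ∑ k ∈ Finset.range n, b k * R k) * (γ' + w * ∑ k ∈ Finset.range n, a k * R' k)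
      - (γ + z * ∑ k ∈ Finset.range n, a k * R k) * (α' + w * ∑ k ∈ Finset.range n, b k * R' k)
      = α * γ' - γ * α' + (z - w) * ∑ k ∈ Finset.range n, R k * R' k := by
  induction n with
  | zero => simp
  | succ n ih =>
    simp only [Finset.sum_range_succ]
    linear_combination ih - z * R n * h' n + w * R' n * h n

lemma determinant_tsum {a b R R' : ℕ → ℂ} {z w α γ α' γ' : ℂ}
    (h : ∀ n, R n = b n * (γ + z * ∑ k ∈ Finset.range n, a k * R k)
      - a n * (α + z * ∑ k ∈ Finset.range n, b k * R k))
    (h' : ∀ n, R' n = b n * (γ' + w * ∑ k ∈ Finset.range n, a k * R' k)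
      - a n * (α' + w * ∑ k ∈ Finset.range n, b k * R' k))
    (ha : Summable fun n => ‖a n‖ ^ 2) (hb : Summable fun n => ‖b n‖ ^ 2)
    (hR : Summable fun n => ‖R n‖ ^ 2) (hR' : Summable fun n => ‖R' n‖ ^ 2) :
    (α + z * ∑' k, b k * R k) * (γ' + w * ∑' k, a k * R' k)
      - (γ + z * ∑' k, a k * R k) * (α' + w * ∑' k, b k * R' k)
      = α * γ' - γ * α' + (z - w) * ∑' k, R k * R' k := by
  have t {f g : ℕ → ℂ} (hf : Summable fun n => ‖f n‖ ^ 2) (hg : Summable fun n => ‖g n‖ ^ 2) :=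
    (summable_mul_of_summable_sq hf hg).hasSum.tendsto_sum_nat
  refine tendsto_nhds_unique (f := fun n => _) (l := atTop)
    ((((t hb hR).const_mul z).const_add α).mul (((t ha hR').const_mul w).const_add γ') |>.sub
      ((((t ha hR).const_mul z).const_add γ).mul (((t hb hR').const_mul w).const_add α'))) ?_
  simp only [determinant_partial_sums h h']
  exact ((t hR hR').const_mul _).const_add _

/-! ### The orthonormal polynomials in `L²(μ)` -/

section L2

open scoped InnerProductSpace

lemma inner_toLp {μ : Measure ℝ} {f g : ℝ → ℂ} (hf : MemLp f 2 μ) (hg : MemLp g 2 μ) :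
    ⟪hf.toLp f, hg.toLp g⟫_ℂ = ∫ x, conj (f x) * g x ∂μ := by
  rw [L2.inner_def]
  refine integral_congr_ae ?_
  filter_upwards [hf.coeFn_toLp, hg.coeFn_toLp] with x h1 h2
  rw [h1, h2, RCLike.inner_apply, mul_comm]

lemma norm_sq_toLp {μ : Measure ℝ} {f : ℝ → ℂ} (hf : MemLp f 2 μ) :
    ‖hf.toLp f‖ ^ 2 = ∫ x, ‖f x‖ ^ 2 ∂μ := by
  have h := inner_toLp hf hf
  rw [inner_self_eq_norm_sq_to_K] at h
  have h2 : ∀ x, conj (f x) * f x = ((‖f x‖ ^ 2 : ℝ) : ℂ) := fun x => by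
    rw [mul_comm, Complex.mul_conj, Complex.normSq_eq_norm_sq]
  simp only [h2, integral_complex_ofReal] at h
  exact Complex.ofReal_injective (by rw [Complex.ofReal_pow]; exact h)

lemma memLp_cauchyKernel {μ : Measure ℝ} (hμ : μ ∈ MStar) {z : ℂ} (hz : z.im ≠ 0) :
    MemLp (fun x : ℝ => 1 / ((x : ℂ) - z)) 2 μ := by
  have := isFiniteMeasure_of_mem_MStar hμ
  exact MemLp.of_bound (continuous_cauchyKernel hz).aestronglyMeasurable _
    (ae_of_all _ (norm_cauchyKernel_le hz))

/-- Complex polynomials as elements of `L²(μ)`. -/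
noncomputable def polyLp {μ : Measure ℝ} (hμ : μ ∈ MStar) : ℂ[X] →ₗ[ℂ] Lp ℂ 2 μ where
  toFun P := (memLp_evalC hμ P).toLp _
  map_add' P Q := by
    rw [← MemLp.toLp_add]
    congr 1
    funext x; simp
  map_smul' a P := by
    rw [RingHom.id_apply, ← MemLp.toLp_const_smul]
    congr 1
    funext x; simp

/-- The Cauchy kernel as an element of `L²(μ)`. -/
noncomputable def kernelLp {μ : Measure ℝ} (hμ : μ ∈ MStar) {z : ℂ} (hz : z.im ≠ 0) :
    Lp ℂ 2 μ := (memLp_cauchyKernel hμ hz).toLp _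

lemma map_conj_complexify (p : ℕ → ℝ[X]) (n : ℕ) :
    (complexify p n).map (starRingEnd ℂ) = complexify p n := by
  rw [complexify, Polynomial.map_map]
  congr 1
  ext x
  simp

lemma orthonormal_polyLp {μ : Measure ℝ} (hμ : μ ∈ MStar) {p : ℕ → ℝ[X]}
    (hp : IsOrthonormalPolynomials μ p) : Orthonormal ℂ fun n => polyLp hμ (complexify p n) := by
  rw [orthonormal_iff_ite]
  intro n m
  rw [← polyIntegralC_mul hμ hp, polyIntegralC_apply]
  refine (inner_toLp (memLp_evalC hμ _) (memLp_evalC hμ _)).trans (integral_congr_ae (ae_of_all _ fun x => ?_))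
  simp only [eval_mul, eval_complexify_ofReal, Complex.conj_ofReal]

lemma inner_polyLp_kernelLp {μ : Measure ℝ} (hμ : μ ∈ MStar) (p : ℕ → ℝ[X]) (n : ℕ) {z : ℂ}
    (hz : z.im ≠ 0) : ⟪polyLp hμ (complexify p n), kernelLp hμ hz⟫_ℂ
      = evalQ μ p n z + stieltjesTransform μ z * evalP p n z := by
  have := isFiniteMeasure_of_mem_MStar hμ
  rw [evalQ_eq hμ, evalP_eq, polyIntegralC_apply, stieltjesTransform, ← integral_mul_const,
    ← integral_add (integrable_evalC hμ _) ((integrable_cauchyKernel hz).mul_const _)]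
  refine (inner_toLp (memLp_evalC hμ _) (memLp_cauchyKernel hμ hz)).trans
    (integral_congr_ae (ae_of_all _ fun x => ?_))
  have h1 := ofReal_sub_ne_zero hz x
  simp only [eval_complexify_ofReal, Complex.conj_ofReal]
  rw [← eval_complexify_ofReal, eval_eq_divDiff z x]
  field_simp
  ring

lemma inner_kernelLp_polyLp {μ : Measure ℝ} (hμ : μ ∈ MStar) (p : ℕ → ℝ[X]) (n : ℕ) {z : ℂ}
    (hz : z.im ≠ 0) (hz' : (conj z).im ≠ 0) :
    ⟪kernelLp hμ hz', polyLp hμ (complexify p n)⟫_ℂ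
      = evalQ μ p n z + stieltjesTransform μ z * evalP p n z := by
  rw [← inner_polyLp_kernelLp hμ p n hz]
  refine (inner_toLp (memLp_cauchyKernel hμ hz') (memLp_evalC hμ _)).trans
    ((integral_congr_ae (ae_of_all _ fun x => ?_)).trans
      (inner_toLp (memLp_evalC hμ _) (memLp_cauchyKernel hμ hz)).symm)
  simp only [eval_complexify_ofReal, Complex.conj_ofReal, map_div₀, map_sub, map_one,
    Complex.conj_conj]
  ring

lemma inner_kernelLp_kernelLp {μ : Measure ℝ} (hμ : μ ∈ MStar) {z w : ℂ}
    (hz' : (conj z).im ≠ 0) (hw : w.im ≠ 0) :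
    (z - w) * ⟪kernelLp hμ hz', kernelLp hμ hw⟫_ℂ
      = stieltjesTransform μ z - stieltjesTransform μ w := by
  have := isFiniteMeasure_of_mem_MStar hμ
  have hz : z.im ≠ 0 := by simpa using hz'
  rw [stieltjesTransform, stieltjesTransform, ← integral_sub (integrable_cauchyKernel hz)
    (integrable_cauchyKernel hw), kernelLp, kernelLp, inner_toLp, ← integral_const_mul]
  refine integral_congr_ae (ae_of_all _ fun x => ?_)
  have h1 := ofReal_sub_ne_zero hz x
  have h2 := ofReal_sub_ne_zero hw x
  simp only [Complex.conj_ofReal, map_div₀, map_sub, map_one, Complex.conj_conj]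
  field_simp
  ring

/-- Parseval's identity holds as soon as one of the two vectors is in the closed span of the
orthonormal family. -/
lemma hasSum_inner_mul_inner_of_mem_closure {E : Type*} [NormedAddCommGroup E]
    [InnerProductSpace ℂ E] [CompleteSpace E] {e : ℕ → E} (he : Orthonormal ℂ e) (x : E) {y : E}
    (hy : y ∈ (Submodule.span ℂ (Set.range e)).topologicalClosure) :
    HasSum (fun n => ⟪x, e n⟫_ℂ * ⟪e n, y⟫_ℂ) ⟪x, y⟫_ℂ := by
  set K := (Submodule.span ℂ (Set.range e)).topologicalClosure with hK
  have : CompleteSpace K := Submodule.topologicalClosure.completeSpace _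
  have hmem (n : ℕ) : e n ∈ K :=
    Submodule.le_topologicalClosure _ (Submodule.subset_span ⟨n, rfl⟩)
  let v (n : ℕ) : K := ⟨e n, hmem n⟩
  have hv : Orthonormal ℂ v := by
    rw [orthonormal_iff_ite] at he ⊢
    exact he
  have hbot : (Submodule.span ℂ (Set.range v))ᗮ = ⊥ := by
    rw [Submodule.eq_bot_iff]
    intro u hu
    have h1 : (u : E) ∈ (Submodule.span ℂ (Set.range e))ᗮ := by
      rw [Submodule.mem_orthogonal]
      intro w hw
      refine Submodule.span_induction ?_ ?_ ?_ ?_ hw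
      · rintro _ ⟨n, rfl⟩
        exact (Submodule.mem_orthogonal _ _).1 hu (v n) (Submodule.subset_span ⟨n, rfl⟩)
      · exact inner_zero_left _
      · intro a b _ _ ha hb
        rw [inner_add_left, ha, hb, add_zero]
      · intro c a _ ha
        rw [inner_smul_left, ha, mul_zero]
    rw [← Submodule.orthogonal_closure] at h1
    have h2 := (Submodule.mem_orthogonal _ _).1 h1 u u.2
    exact Subtype.ext (inner_self_eq_zero.1 h2)
  let B := HilbertBasis.mkOfOrthogonalEqBot hv hbot
  have hB (n : ℕ) : B n = v n := congrFun (HilbertBasis.coe_mkOfOrthogonalEqBot hv hbot) n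
  have h := (B.hasSum_repr ⟨y, hy⟩).mapL (innerSL ℂ x ∘L K.subtypeL)
  refine h.congr_fun fun n => ?_
  rw [B.repr_apply_apply, hB]
  simp only [ContinuousLinearMap.comp_apply, map_smul, smul_eq_mul, Submodule.subtypeL_apply,
    innerSL_apply_apply, Submodule.coe_inner, v]
  ring

/-- If the evaluation at `i` is unbounded for the damped measure, the Cauchy kernel at `i` is a
limit of polynomials in `L²(μ)`. -/
lemma kernelLp_I_mem_closure {μ : Measure ℝ} (hμ : μ ∈ MStar) {p : ℕ → ℝ[X]}
    (hp : IsOrthonormalPolynomials μ p) (h : ¬ EvalBounded (damp 1 μ) Complex.I)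
    (hI : Complex.I.im ≠ 0) : kernelLp hμ hI ∈ (Submodule.span ℂ (Set.range fun n =>
      polyLp hμ (complexify p n))).topologicalClosure := by
  change _ ∈ closure (_ : Set (Lp ℂ 2 μ))
  rw [Metric.mem_closure_iff]
  intro ε hε
  obtain ⟨P, hP1, hP2⟩ := exists_eval_one_of_not_evalBounded h (pow_pos hε 2)
  rw [integral_damp_one] at hP2
  have hspan (Q : ℂ[X]) : polyLp hμ Q ∈ Submodule.span ℂ (Set.range fun n =>
      polyLp hμ (complexify p n)) := by
    obtain ⟨c, hc⟩ := exists_coeff_of_degree_lt hp (Q.natDegree + 1)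
      (degree_le_natDegree.trans_lt (by exact_mod_cast Nat.lt_succ_self _))
    rw [hc, map_sum]
    refine Submodule.sum_mem _ fun k _ => ?_
    rw [map_smul]
    exact Submodule.smul_mem _ _ (Submodule.subset_span ⟨k, rfl⟩)
  refine ⟨polyLp hμ (-divDiff Complex.I P), hspan _, ?_⟩
  rw [dist_eq_norm, kernelLp]
  change ‖_ - (memLp_evalC hμ (-divDiff Complex.I P)).toLp _‖ < ε
  rw [← MemLp.toLp_sub]
  refine lt_of_pow_lt_pow_left₀ 2 hε.le ?_
  rw [norm_sq_toLp]
  refine lt_of_eq_of_lt (integral_congr_ae (ae_of_all _ fun x => ?_)) hP2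
  have h1 := ofReal_sub_ne_zero hI x
  have h2 : 1 / ((x : ℂ) - Complex.I) - (-divDiff Complex.I P).eval (x : ℂ)
      = P.eval (x : ℂ) / ((x : ℂ) - Complex.I) := by
    rw [eval_eq_divDiff Complex.I x P, hP1]
    field_simp
    simp
  simp only [Pi.sub_apply]
  rw [h2, norm_div, div_pow, norm_sq_ofReal_sub_I]

end L2

/-! ### N-extremality from a limit of polynomials -/

/-- The bound for the evaluation at `w` applied to the kernel polynomials
`∑ conj (p n w) * p n`. -/
lemma summable_sq_evalP_of_evalBounded {μ : Measure ℝ} (hμ : μ ∈ MStar) {p : ℕ → ℝ[X]}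
    (hp : IsOrthonormalPolynomials μ p) {w : ℂ} (h : EvalBounded μ w) :
    Summable fun n => ‖evalP p n w‖ ^ 2 := by
  obtain ⟨K, hK0, hK⟩ := h.exists_pos
  refine summable_of_sum_range_le (c := K) (fun n => sq_nonneg _) fun N => ?_
  set S : ℝ := ∑ n ∈ Finset.range N, ‖evalP p n w‖ ^ 2 with hS
  have hS0 : 0 ≤ S := Finset.sum_nonneg fun n _ => sq_nonneg _
  let P : ℂ[X] := ∑ n ∈ Finset.range N, conj (evalP p n w) • complexify p n
  have hmul (n : ℕ) : conj (evalP p n w) * evalP p n w = ((‖evalP p n w‖ ^ 2 : ℝ) : ℂ) := by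
    rw [mul_comm, Complex.mul_conj, Complex.normSq_eq_norm_sq]
  have hPw : P.eval w = (S : ℂ) := by
    simp only [P, eval_finsetSum, eval_smul, smul_eq_mul, ← evalP_eq, hmul]
    rw [hS, Complex.ofReal_sum]
  have hPconj : P.map (starRingEnd ℂ) = ∑ n ∈ Finset.range N, evalP p n w • complexify p n := by
    simp only [P, Polynomial.map_sum, Polynomial.map_smul, Complex.conj_conj, map_conj_complexify]
  have hnorm : ∫ x : ℝ, ‖P.eval (x : ℂ)‖ ^ 2 ∂μ = S := by
    have h1 : polyIntegralC hμ (P * P.map (starRingEnd ℂ)) = (S : ℂ) := by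
      rw [hPconj, Finset.sum_mul, map_sum, hS, Complex.ofReal_sum]
      refine Finset.sum_congr rfl fun n hn => ?_
      rw [Finset.mul_sum, map_sum]
      simp only [smul_mul_smul_comm, map_smul, polyIntegralC_mul hμ hp, smul_eq_mul, mul_ite,
        mul_one, mul_zero, Finset.sum_ite_eq, hn, if_true, hmul]
    rw [polyIntegralC_apply] at h1
    simp only [eval_mul_map_conj, integral_complex_ofReal] at h1
    exact_mod_cast h1
  have h1 := hK P
  rw [hPw, hnorm, Complex.norm_real, Real.norm_of_nonneg hS0] at h1
  by_contra! h2
  nlinarith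

lemma divDiff_map_conj (w : ℂ) (P : ℂ[X]) :
    divDiff (conj w) (P.map (starRingEnd ℂ)) = (divDiff w P).map (starRingEnd ℂ) := by
  refine divDiff_unique (c := conj (P.eval w)) ?_
  have h := congrArg (Polynomial.map (starRingEnd ℂ)) (mul_divDiff w P)
  simp only [Polynomial.map_add, Polynomial.map_mul, Polynomial.map_sub, map_X, map_C] at h
  exact h.symm

lemma evalP_conj (p : ℕ → ℝ[X]) (n : ℕ) (z : ℂ) : evalP p n (conj z) = conj (evalP p n z) := by
  rw [evalP_eq, evalP_eq]
  conv_lhs => rw [← map_conj_complexify]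
  rw [eval_map_conj, Complex.conj_conj]

lemma evalQ_conj {μ : Measure ℝ} (hμ : μ ∈ MStar) (p : ℕ → ℝ[X]) (n : ℕ) (z : ℂ) :
    evalQ μ p n (conj z) = conj (evalQ μ p n z) := by
  rw [evalQ_eq hμ, evalQ_eq hμ]
  conv_lhs => rw [← map_conj_complexify]
  rw [divDiff_map_conj, polyIntegralC_apply, polyIntegralC_apply, ← integral_conj]
  simp only [eval_map_conj, Complex.conj_ofReal]

lemma stieltjesTransform_conj (μ : Measure ℝ) (z : ℂ) :
    stieltjesTransform μ (conj z) = conj (stieltjesTransform μ z) := by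
  rw [stieltjesTransform, stieltjesTransform, ← integral_conj]
  simp

/-- The values `A + s B` and `C + s D`, with `s` the Stieltjes transform of `μ`, in terms of the
coefficients `q n + s * p n` of the Cauchy kernel. -/
noncomputable def nevPair (μ : Measure ℝ) (p : ℕ → ℝ[X]) (z : ℂ) : ℂ × ℂ :=
  (-stieltjesTransform μ z
      + z * ∑' n, evalQ μ p n 0 * (evalQ μ p n z + stieltjesTransform μ z * evalP p n z),
    1 + z * ∑' n, evalP p n 0 * (evalQ μ p n z + stieltjesTransform μ z * evalP p n z))

lemma nevPair_conj {μ : Measure ℝ} (hμ : μ ∈ MStar) (p : ℕ → ℝ[X]) (z : ℂ) :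
    (nevPair μ p (conj z)).1 = conj (nevPair μ p z).1 ∧
      (nevPair μ p (conj z)).2 = conj (nevPair μ p z).2 := by
  have h0 (n : ℕ) : conj (evalP p n 0) = evalP p n 0 := by simpa using (evalP_conj p n 0).symm
  have h1 (n : ℕ) : conj (evalQ μ p n 0) = evalQ μ p n 0 := by
    simpa using (evalQ_conj hμ p n 0).symm
  simp only [nevPair, map_add, map_mul, map_neg, map_one, Complex.conj_tsum, h0, h1,
    evalP_conj, evalQ_conj hμ, stieltjesTransform_conj, and_self]

/-- Suppose that evaluation is bounded at one point off the real line and that the Cauchy kernel at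
`i` is a limit of polynomials in `L²(μ)`. Parseval's identity for the kernels at `z` and at `i`
makes the pair `(A + s B, C + s D)` at `z` proportional to its value at `i`, and to its complex
conjugate for `z = -i`. So the parameter in the Nevanlinna parametrization is a real constant or
infinite. -/
theorem isNExtremal_of_evalBounded {μ : Measure ℝ} (hμ : μ ∈ MStar) {w : ℂ} (hw : w.im ≠ 0)
    (hbdd : EvalBounded μ w) (hunb : ¬ EvalBounded (damp 1 μ) Complex.I) : IsNExtremal μ := by
  set p := orthPoly hμ
  have hp : IsOrthonormalPolynomials μ p := isOrthonormalPolynomials_orthPoly hμ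
  set s := stieltjesTransform μ
  set r : ℂ → ℕ → ℂ := fun z n => evalQ μ p n z + s z * evalP p n z with hr
  have hI : Complex.I.im ≠ 0 := by simp
  have hrsq {z : ℂ} (hz : z.im ≠ 0) : Summable fun n => ‖r z n‖ ^ 2 := by
    have h := (orthonormal_polyLp hμ hp).inner_products_summable (x := kernelLp hμ hz)
    simpa only [inner_polyLp_kernelLp hμ p _ hz] using h
  have hPw : Summable fun n => ‖evalP p n w‖ ^ 2 := summable_sq_evalP_of_evalBounded hμ hp hbdd
  have hQw : Summable fun n => ‖evalQ μ p n w‖ ^ 2 := by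
    have h1 : Summable fun n => ‖-s w * evalP p n w‖ ^ 2 := by
      simpa only [norm_mul, mul_pow] using hPw.mul_left (‖-s w‖ ^ 2)
    refine Summable.of_nonneg_of_le (fun n => sq_nonneg _) (fun n => ?_)
      (summable_sq_norm_add (hrsq hw) h1)
    gcongr
    have h2 : evalQ μ p n w = r w n + -s w * evalP p n w := by simp only [hr]; ring
    conv_lhs => rw [h2]
    exact norm_add_le _ _
  have hP (z : ℂ) : Summable fun n => ‖evalP p n z‖ ^ 2 :=
    summable_sq_of_recursion hPw hQw (fun n => le_add_of_nonneg_right (norm_nonneg _))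
      fun n => evalP_sub_evalP hμ hp n z w
  have hQ (z : ℂ) : Summable fun n => ‖evalQ μ p n z‖ ^ 2 :=
    summable_sq_of_recursion hPw hQw (fun n => le_add_of_nonneg_left (norm_nonneg _))
      fun n => evalQ_sub_evalQ hμ hp n z w
  have hrecP (z : ℂ) (n : ℕ) : evalP p n z
      = evalQ μ p n 0 * (0 + z * ∑ k ∈ Finset.range n, evalP p k 0 * evalP p k z)
        - evalP p n 0 * (-1 + z * ∑ k ∈ Finset.range n, evalQ μ p k 0 * evalP p k z) := by
    have h := evalP_sub_evalP hμ hp n z 0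
    simp only [sub_mul, Finset.sum_sub_distrib, sub_zero] at h
    have h1 : ∑ k ∈ Finset.range n, evalP p k 0 * evalQ μ p n 0 * evalP p k z
        = evalQ μ p n 0 * ∑ k ∈ Finset.range n, evalP p k 0 * evalP p k z := by
      rw [Finset.mul_sum]; exact Finset.sum_congr rfl fun k _ => by ring
    have h2 : ∑ k ∈ Finset.range n, evalP p n 0 * evalQ μ p k 0 * evalP p k z
        = evalP p n 0 * ∑ k ∈ Finset.range n, evalQ μ p k 0 * evalP p k z := by
      rw [Finset.mul_sum]; exact Finset.sum_congr rfl fun k _ => by ring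
    rw [h1, h2] at h
    linear_combination h
  have hrecQ (z : ℂ) (n : ℕ) : evalQ μ p n z
      = evalQ μ p n 0 * (1 + z * ∑ k ∈ Finset.range n, evalP p k 0 * evalQ μ p k z)
        - evalP p n 0 * (0 + z * ∑ k ∈ Finset.range n, evalQ μ p k 0 * evalQ μ p k z) := by
    have h := evalQ_sub_evalQ hμ hp n z 0
    simp only [sub_mul, Finset.sum_sub_distrib, sub_zero] at h
    have h1 : ∑ k ∈ Finset.range n, evalP p k 0 * evalQ μ p n 0 * evalQ μ p k z
        = evalQ μ p n 0 * ∑ k ∈ Finset.range n, evalP p k 0 * evalQ μ p k z := by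
      rw [Finset.mul_sum]; exact Finset.sum_congr rfl fun k _ => by ring
    have h2 : ∑ k ∈ Finset.range n, evalP p n 0 * evalQ μ p k 0 * evalQ μ p k z
        = evalP p n 0 * ∑ k ∈ Finset.range n, evalQ μ p k 0 * evalQ μ p k z := by
      rw [Finset.mul_sum]; exact Finset.sum_congr rfl fun k _ => by ring
    rw [h1, h2] at h
    linear_combination h
  have hrecr (z : ℂ) (n : ℕ) : r z n
      = evalQ μ p n 0 * (1 + z * ∑ k ∈ Finset.range n, evalP p k 0 * r z k)
        - evalP p n 0 * (-s z + z * ∑ k ∈ Finset.range n, evalQ μ p k 0 * r z k) := by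
    have h1 (a : ℕ → ℂ) : ∑ k ∈ Finset.range n, a k * r z k
        = ∑ k ∈ Finset.range n, a k * evalQ μ p k z
          + s z * ∑ k ∈ Finset.range n, a k * evalP p k z := by
      rw [Finset.mul_sum, ← Finset.sum_add_distrib]
      exact Finset.sum_congr rfl fun k _ => by simp only [hr]; ring
    rw [h1, h1]
    simp only [hr]
    linear_combination hrecQ z n + s z * hrecP z n
  have hdet (z : ℂ) : nevA μ p z * nevD p z - nevC μ p z * nevB μ p z = 1 := by
    have h := determinant_tsum (hrecQ z) (hrecP z) (hP 0) (hQ 0) (hQ z) (hP z)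
    simp only [zero_add, sub_self, zero_mul, add_zero, mul_zero] at h
    rw [nevA, nevB, nevC, nevD, h]
    ring
  have htsum (a : ℕ → ℂ) (ha : Summable fun n => ‖a n‖ ^ 2) (z : ℂ) : ∑' k, a k * r z k
      = ∑' k, a k * evalQ μ p k z + s z * ∑' k, a k * evalP p k z := by
    rw [← tsum_mul_left, ← (summable_mul_of_summable_sq ha (hQ z)).tsum_add
      ((summable_mul_of_summable_sq ha (hP z)).mul_left _)]
    exact tsum_congr fun k => by simp only [hr]; ring
  have hpair1 (z : ℂ) : (nevPair μ p z).1 = nevA μ p z + s z * nevB μ p z := by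
    change -s z + z * ∑' k, evalQ μ p k 0 * r z k = _
    rw [htsum _ (hQ 0), nevA, nevB]
    ring
  have hpair2 (z : ℂ) : (nevPair μ p z).2 = nevC μ p z + s z * nevD p z := by
    change 1 + z * ∑' k, evalP p k 0 * r z k = _
    rw [htsum _ (hP 0), nevC, nevD]
    ring
  have hprop {z : ℂ} (hz : z.im ≠ 0) : (nevPair μ p z).1 * (nevPair μ p Complex.I).2
      = (nevPair μ p z).2 * (nevPair μ p Complex.I).1 := by
    have hz' : (conj z).im ≠ 0 := by simpa using hz
    have h1 := determinant_tsum (hrecr z) (hrecr Complex.I) (hP 0) (hQ 0) (hrsq hz) (hrsq hI)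
    have h2 := hasSum_inner_mul_inner_of_mem_closure (orthonormal_polyLp hμ hp)
      (kernelLp hμ hz') (kernelLp_I_mem_closure hμ hp hunb hI)
    simp only [inner_kernelLp_polyLp hμ p _ hz hz', inner_polyLp_kernelLp hμ p _ hI] at h2
    have h3 := inner_kernelLp_kernelLp hμ hz' hI
    rw [← h2.tsum_eq] at h3
    have h4 : (nevPair μ p z).1 * (nevPair μ p Complex.I).2
        - (nevPair μ p z).2 * (nevPair μ p Complex.I).1
        = -s z * 1 - 1 * -s Complex.I + (z - Complex.I) * ∑' k, r z k * r Complex.I k := h1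
    have h5 : (z - Complex.I) * ∑' k, r z k * r Complex.I k = s z - s Complex.I := h3
    rw [h5] at h4
    linear_combination h4
  refine ⟨p, hp, ?_⟩
  by_cases hγ : (nevPair μ p Complex.I).2 = 0
  · right
    have hα : (nevPair μ p Complex.I).1 ≠ 0 := by
      intro hα
      rw [hpair1] at hα
      rw [hpair2] at hγ
      have h := hdet Complex.I
      have : (1 : ℂ) = 0 := by
        linear_combination -h + nevD p Complex.I * hα - nevB μ p Complex.I * hγ
      exact one_ne_zero this
    intro z hz
    have h1 := hprop hz
    rw [hγ, mul_zero] at h1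
    have h2 := (mul_eq_zero.1 h1.symm).resolve_right hα
    rw [hpair2] at h2
    have hD : nevD p z ≠ 0 := by
      intro h0
      have h := hdet z
      rw [h0, mul_zero, add_zero] at h2
      simp [h0, h2] at h
    rw [← neg_div, eq_div_iff hD]
    linear_combination h2
  · left
    set t₀ : ℂ := -((nevPair μ p Complex.I).1 / (nevPair μ p Complex.I).2) with ht₀
    have hreal : conj t₀ = t₀ := by
      have hcI : (conj Complex.I).im ≠ 0 := by simp
      have h1 := hprop hcI
      rw [(nevPair_conj hμ p Complex.I).1, (nevPair_conj hμ p Complex.I).2] at h1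
      have hγ' : conj (nevPair μ p Complex.I).2 ≠ 0 := (_root_.map_ne_zero _).2 hγ
      rw [ht₀, map_neg, map_div₀]
      congr 1
      rw [div_eq_div_iff hγ' hγ, h1]
      ring
    obtain ⟨t, ht⟩ := Complex.conj_eq_iff_real.1 hreal
    refine ⟨t, fun z hz => ?_⟩
    rw [← ht]
    have h1 := hprop hz
    have h2 : (nevPair μ p z).1 + t₀ * (nevPair μ p z).2 = 0 := by
      rw [ht₀]
      field_simp
      linear_combination h1
    rw [hpair1, hpair2] at h2
    have hD : nevB μ p z + t₀ * nevD p z ≠ 0 := by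
      intro h0
      have h3 : nevA μ p z + t₀ * nevC μ p z = 0 := by linear_combination h2 - s z * h0
      have : (1 : ℂ) = 0 := by
        rw [← hdet z]
        linear_combination nevD p z * h3 - nevC μ p z * h0
      exact one_ne_zero this
    rw [← neg_div, eq_div_iff hD]
    linear_combination h2

/-! ### Damping of indeterminate measures -/

lemma exists_evalBounded_of_mem_MIndet {μ : Measure ℝ} (hμ : μ ∈ MIndet) :
    ∃ z : ℂ, z.im ≠ 0 ∧ EvalBounded μ z := by
  by_contra! h
  obtain ⟨τ, hτ, hne⟩ := hμ.2
  exact hne ((mem_MDet_of_not_evalBounded hμ.1 h).2 τ hτ)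

lemma mem_MIndet_of_evalBounded {μ : Measure ℝ} (hμ : μ ∈ MStar)
    (h : EvalBounded μ Complex.I) : μ ∈ MIndet :=
  ⟨hμ, exists_ne_of_evalBounded hμ h⟩

lemma not_evalBounded_of_mem_MDet {μ : Measure ℝ} (hμ : μ ∈ MDet) :
    ¬ EvalBounded μ Complex.I := fun h => by
  obtain ⟨τ, hτ, hne⟩ := exists_ne_of_evalBounded hμ.1 h
  exact hne (hμ.2 τ hτ)

lemma mem_MIndetNExt {μ : Measure ℝ} (hμ : μ ∈ MIndet)
    (h : ¬ EvalBounded (damp 1 μ) Complex.I) : μ ∈ MIndetNExt := by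
  obtain ⟨z, hz, hb⟩ := exists_evalBounded_of_mem_MIndet hμ
  exact ⟨hμ, isNExtremal_of_evalBounded hμ.1 hz hb h⟩

lemma setB_subset_MIndetNExt {α : ℝ} (hα0 : 0 ≤ α) (hα1 : α ≤ 1) : setB α ⊆ MIndetNExt :=
  fun _ hμ => mem_MIndetNExt hμ.1 fun h =>
    not_evalBounded_of_mem_MDet hμ.2 (h.mono (damp_anti hα1 _) (damp_mem_MStar hα0 hμ.1.1))

lemma damp_lacMeasure_mem_MIndet {β : ℝ} (hβ0 : 0 ≤ β) (hβ1 : β < 1) :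
    damp β lacMeasure ∈ MIndet :=
  mem_MIndet_of_evalBounded (damp_mem_MStar hβ0 lacMeasure_mem_MStar)
    (evalBounded_damp_lacMeasure hβ0 hβ1)

lemma lacMeasure_mem_MIndet : lacMeasure ∈ MIndet := by
  simpa only [damp_zero] using damp_lacMeasure_mem_MIndet le_rfl one_pos

lemma lacMeasure_mem_setA_inter {α : ℝ} (hα0 : 0 ≤ α) (hα1 : α < 1) :
    lacMeasure ∈ setA α ∩ MIndetNExt :=
  ⟨⟨lacMeasure_mem_MIndet, damp_lacMeasure_mem_MIndet hα0 hα1⟩,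
    mem_MIndetNExt lacMeasure_mem_MIndet (not_evalBounded_damp_one_lacMeasure (by simp))⟩

lemma damp_lacMeasure_mem_setB {α : ℝ} (hα0 : 0 < α) (hα1 : α ≤ 1) :
    damp (1 - α) lacMeasure ∈ setB α := by
  refine ⟨damp_lacMeasure_mem_MIndet (by linarith) (by linarith), ?_⟩
  rw [damp_damp, add_sub_cancel]
  exact mem_MDet_of_not_evalBounded (damp_mem_MStar zero_le_one lacMeasure_mem_MStar)
    fun z hz => not_evalBounded_damp_one_lacMeasure hz

end HamburgerMoment

theorem mainTheorem1 (α : ℝ) (hα0 : 0 < α) (hα1 : α < 1) :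
    (HamburgerMoment.setA α ∩ HamburgerMoment.MIndetNExt).Nonempty ∧
      (HamburgerMoment.setB α).Nonempty ∧
      HamburgerMoment.setB α ⊆ HamburgerMoment.MIndetNExt :=
  ⟨⟨_, HamburgerMoment.lacMeasure_mem_setA_inter hα0.le hα1⟩,
    ⟨_, HamburgerMoment.damp_lacMeasure_mem_setB hα0 hα1.le⟩,
    HamburgerMoment.setB_subset_MIndetNExt hα0.le hα1.le⟩
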